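/- Let $N\ge 1$ and let $\mu$ be a Borel probability measure on $\mathbb R^N$. For $t\in\{1,\dots,N\}$ let $\mu^{x_1,\dots,x_{t-1}}(dx_t)$ denote the regular conditional law under $\mu$ of the $t$-th coordinate given the first $t-1$ coordinates. Lipschitz properties are understood with respect to the norm $\|x\|_1=\sum_i|x_i|$. Assume: (EXP) for each $t\in\{1,\dots,N\}$ there are $a_t>0$ and $\lambda_t\in\mathbb R$ such that $\int e^{a_t x_t^2}\,\mu^{x_1,\dots,x_{t-1}}(dx_t)\le e^{\lambda_t}$ $\mu$-a.s.; (LIP) there is $C>0$ such that for every $t\in\{1,\dots,N\}$ and every $1$-Lipschitz $f:\mathbb R\to\mathbb R$ the function $(x_1,\dots,x_{t-1})\mapsto\int f(x_t)\,\mu^{x_1,\dots,x_{t-1}}(dx_t)$ is $\mu$-a.s. equal to a $C$-Lipschitz function. For probability measures $\mu,\nu$ on $\mathbb R^N$, a coupling $\gamma$ of $\mu$ and $\nu$ is called causal from $\mu$ to $\nu$ if for all $t\in\{1,\dots,N\}$ and all $B$ in the $\sigma$-algebra $\mathcal F_t$ generated by the first $t$ coordinates, the map $x\mapsto\gamma^x(B)$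 is, up to a $\mu$-null set, $\mathcal F_t$-measurable, where $\gamma^x$ is the regular conditional law under $\gamma$ of the second component given that the first one is $x$. It is called bicausal, $\gamma\in\Pi_{bc}(\mu,\nu)$, if in addition its image under $(x,y)\mapsto(y,x)$ is causal from $\nu$ to $\mu$. Put $$K:=\sqrt{2\sum_{j=0}^{N-1}(1+C)^{2j}\,\frac{1+\lambda_{N-j}}{a_{N-j}}}.$$ Then for every Borel probability measure $\nu$ on $\mathbb R^N$, $$\mathcal W_{1,bc}(\mu,\nu):=\inf_{\gamma\in\Pi_{bc}(\mu,\nu)}\int\|x-y\|_1\,d\gamma(x,y)\le K\sqrt{\mathrm{Ent}(\nu|\mu)},$$ where $\mathrm{Ent}(\nu|\mu)=\int\log\frac{d\nu}{d\mu}\,d\nu$ if $\nu\ll\mu$ and $+\infty$ otherwise. Moreover, for every $r\ge 0$ and every $H:\mathbb R^N\times\mathbb R^N\to\mathbb R$ that is bounded from below, $r$-Lipschitz in its first argument (uniformly in the second) and convex in its second argument, one has, for every Borel probability measure $\nu$ on $\mathbb R^N$, $$|v(\mu)-v(\nu)|\le rK\sqrt{\mathrm{Ent}(\nu|\mu)}$$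 (with the convention $0\cdot\infty=0$), where $$v(\eta):=\inf_{u_1,\dots,u_N}\int H\bigl(x_1,\dots,x_N,u_1(x_1),u_2(x_1,x_2),\dots,u_N(x_1,\dots,x_N)\bigr)\,\eta(dx)\in(-\infty,+\infty],$$ the infimum being taken over Borel functions $u_t:\mathbb R^t\to\mathbb R$. -/

import Mathlib

open MeasureTheory ProbabilityTheory

noncomputable section

/-- The first `k` coordinates `(x_1, …, x_k)` of a path `x ∈ ℝ^N`. -/
def initSeg {N : ℕ} (k : ℕ) (hk : k ≤ N) (x : Fin N → ℝ) : Fin k → ℝ :=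
  fun i => x (Fin.castLE hk i)

/-- The `ℓ¹` distance `‖x - y‖₁ = ∑ i, |x i - y i|`. -/
def l1Dist {k : ℕ} (x y : Fin k → ℝ) : ℝ := ∑ i, |x i - y i|

/-- The coordinate `σ`-algebra on `ℝ^N` generated by `x ↦ (x_1, …, x_t)`; time is indexed by
`t : Fin N`, so that the `0`-based index `t` stands for time `t + 1`. -/
abbrev coordSigma {N : ℕ} (t : Fin N) : MeasurableSpace (Fin N → ℝ) :=
  MeasurableSpace.comap (initSeg (t + 1) t.isLt) MeasurableSpace.pi

/-- The regular conditional law `μ^{x_1, …, x_{t-1}}(dx_t)` of the coordinate at (`0`-based)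
index `t` given the coordinates strictly before it. -/
def condLaw {N : ℕ} (μ : Measure (Fin N → ℝ)) [IsFiniteMeasure μ] (t : Fin N) :
    Kernel (Fin t → ℝ) ℝ :=
  condDistrib (fun x : Fin N → ℝ => x t) (initSeg t t.isLt.le) μ

/-- Condition (EXP): `∫ exp (a_t x_t²) μ^{x_1, …, x_{t-1}}(dx_t) ≤ exp (lam_t)`, `μ`-a.s.,
for every `t`. -/
def CondEXP {N : ℕ} (μ : Measure (Fin N → ℝ)) [IsFiniteMeasure μ] (a lam : Fin N → ℝ) : Prop :=
  ∀ t : Fin N, ∀ᵐ x ∂μ,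
    ∫⁻ z, ENNReal.ofReal (Real.exp (a t * z ^ 2)) ∂(condLaw μ t (initSeg t t.isLt.le x))
      ≤ ENNReal.ofReal (Real.exp (lam t))

/-- Condition (LIP): for every `t` and every `1`-Lipschitz `f : ℝ → ℝ`, the function
`(x_1, …, x_{t-1}) ↦ ∫ f(x_t) μ^{x_1, …, x_{t-1}}(dx_t)` is `μ`-a.s. equal to a function that is
`C`-Lipschitz for the `ℓ¹` norm. -/
def CondLIP {N : ℕ} (μ : Measure (Fin N → ℝ)) [IsFiniteMeasure μ] (C : ℝ) : Prop :=
  ∀ t : Fin N, ∀ f : ℝ → ℝ, LipschitzWith 1 f →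
    ∃ g : (Fin t → ℝ) → ℝ, (∀ p q, |g p - g q| ≤ C * l1Dist p q) ∧
      ∀ᵐ x ∂μ, ∫ z, f z ∂(condLaw μ t (initSeg t t.isLt.le x)) = g (initSeg t t.isLt.le x)

/-- `γ` is a causal transport plan from `μ` to `ν`: it has marginals `μ`, `ν`, and for every `t`
and `B ∈ F_t` the map `x ↦ γ^x(B)` is `F_t`-measurable modulo a `μ`-null set, where `γ^x` is the
regular disintegration of `γ` with respect to its first coordinate. -/
def IsCausalPlan {N : ℕ} (μ ν : Measure (Fin N → ℝ))
    (γ : Measure ((Fin N → ℝ) × (Fin N → ℝ))) [IsFiniteMeasure γ] : Prop :=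
  γ.map Prod.fst = μ ∧ γ.map Prod.snd = ν ∧
    ∀ t : Fin N, ∀ B : Set (Fin N → ℝ), MeasurableSet[coordSigma t] B →
      ∃ g : (Fin N → ℝ) → ENNReal, Measurable[coordSigma t] g ∧
        (fun x => γ.condKernel x B) =ᵐ[μ] g

/-- The set of bicausal transport plans between `μ` and `ν`: plans that are causal from `μ` to `ν`
and whose image under `(x, y) ↦ (y, x)` is causal from `ν` to `μ`. -/
def bicausalPlans {N : ℕ} (μ ν : Measure (Fin N → ℝ)) :
    Set (ProbabilityMeasure ((Fin N → ℝ) × (Fin N → ℝ))) :=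
  {γ | IsCausalPlan μ ν (γ : Measure ((Fin N → ℝ) × (Fin N → ℝ))) ∧
    IsCausalPlan ν μ ((γ : Measure ((Fin N → ℝ) × (Fin N → ℝ))).map Prod.swap)}

/-- The bicausal Wasserstein distance of order one,
`inf { ∫ ‖x - y‖₁ dγ : γ bicausal between μ and ν }`, with values in `[0, ∞]`. -/
def bicausalW1 {N : ℕ} (μ ν : Measure (Fin N → ℝ)) : ENNReal :=
  ⨅ γ ∈ bicausalPlans μ ν,
    ∫⁻ p, ENNReal.ofReal (l1Dist p.1 p.2) ∂(γ : Measure ((Fin N → ℝ) × (Fin N → ℝ)))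

/-- The extended integral `∫ f⁺ dη - ∫ f⁻ dη`. If `f` is bounded from below and `η` is a finite
measure, the second term is finite and the value lies in `(-∞, ∞]`. -/
def extIntegral {α : Type*} [MeasurableSpace α] (η : Measure α) (f : α → ℝ) : EReal :=
  ((∫⁻ x, ENNReal.ofReal (f x) ∂η : ENNReal) : EReal) -
    ((∫⁻ x, ENNReal.ofReal (-f x) ∂η : ENNReal) : EReal)

/-- Borel adapted controls: families of Borel functions `u_t(x_1, …, x_t)`. -/
def adaptedControls (N : ℕ) : Set ((t : Fin N) → (Fin (t + 1) → ℝ) → ℝ) :=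
  {u | ∀ t, Measurable (u t)}

/-- The value of the multistage stochastic program with objective `H` and noise distribution `η`,
`inf_u ∫ H(x, u_1(x_1), …, u_N(x_1, …, x_N)) η(dx)` over Borel adapted controls. -/
def progValue {N : ℕ} (H : (Fin N → ℝ) → (Fin N → ℝ) → ℝ) (η : Measure (Fin N → ℝ)) : EReal :=
  ⨅ u ∈ adaptedControls N,
    extIntegral η (fun x => H x (fun t => u t (initSeg (t + 1) t.isLt x)))

/-- The constant `√(2 ∑_{j < N} (1 + C)^{2j} (1 + lam_{N-j}) / a_{N-j})`; the (`1`-based) time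
`N - j` has `0`-based index `Fin.rev j`. -/
def bicausalConst {N : ℕ} (a lam : Fin N → ℝ) (C : ℝ) : ℝ :=
  Real.sqrt (2 * ∑ j : Fin N, (1 + C) ^ (2 * (j : ℕ)) * ((1 + lam (Fin.rev j)) / a (Fin.rev j)))

end

/-! ### A weighted Pinsker inequality -/

section WeightedPinsker

open InformationTheory Real

/-! The plan is built one time step at a time: given pasts (x, y), the next laws μ^x and ν^y are
coupled by feeding one uniform variable to both quantile functions. The cost of this coupling is at
most any bound on ∫ f dμ^x - ∫ f dν^y over 1-Lipschitz f (`lintegral_quantile_sub_le`). Inserting ∫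
f dμ^y splits the gap in two: (LIP) bounds the first part by C‖x - y‖₁, and the weighted Pinsker
inequality with (EXP) bounds the second by √(2 (1+λ)/a · Ent(ν^y|μ^y))
(`lintegral_abs_mul_abs_sub_one_le`). After averaging and Jensen, the accumulated cost satisfies Δ_t
≤ (1+C) Δ_{t-1} + √(2 (1+λ_t)/a_t · h_t), where h_t is the averaged conditional entropy. Unrolling
this, the chain rule ∑ h_t ≤ Ent(ν|μ) and Cauchy–Schwarz in t produce K.

Bicausality and stability of programs rest on one representation (`IsNoiseTransport`): in both
directions the plan is the law of (x, Φ(x, ω)) with ω independent of x and Φ adapted. Then γ^x is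
the law of Φ(x, ·), whose first t coordinates see only x_1, …, x_t; this is causality. Moreover, a
control u for ν becomes, for each frozen ω, a control u ∘ Φ(·, ω) for μ. Its expected cost is at
least v(μ), and averaging over ω gives v(μ) ≤ v(ν) + r ∫ ‖x - y‖₁ dγ. The reverse inequality is
symmetric. -/

lemma sq_sub_one_le_mul_klFun {u : ℝ} (hu : 0 ≤ u) :
    (u - 1) ^ 2 ≤ (4 / 3 + 2 / 3 * u) * klFun u := by
  -- F is the right side minus the left. Its derivative is 4/3 · G, and G' = log x + 1/x - 1 ≥ 0
  -- with G 1 = 0, so F is minimal at 1, where it vanishes.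
  let F : ℝ → ℝ := fun u => (4 / 3 + 2 / 3 * u) * klFun u - (u - 1) ^ 2
  let G : ℝ → ℝ := fun u => (u + 1) * log u - 2 * (u - 1)
  have hG : ∀ x, 0 < x → HasDerivAt G (log x + (x + 1) / x - 2) x := by
    intro x hx
    have := (((hasDerivAt_id x).add_const 1).mul (hasDerivAt_log hx.ne')).sub
      (((hasDerivAt_id x).sub_const 1).const_mul 2)
    refine this.congr_deriv ?_
    simp only [id]; field_simp
  have hGmono : MonotoneOn G (Set.Ioi 0) := by
    refine monotoneOn_of_deriv_nonneg (convex_Ioi 0)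
      (fun x hx => (hG x hx).continuousAt.continuousWithinAt) ?_ ?_
    · rw [interior_Ioi]
      exact fun x hx => (hG x hx).differentiableAt.differentiableWithinAt
    · rw [interior_Ioi]
      intro x hx
      have hx' : (0 : ℝ) < x := hx
      rw [(hG x hx').deriv]
      have h1 := one_sub_inv_le_log_of_pos hx'
      have h2 : (x + 1) / x = 1 + x⁻¹ := by field_simp
      linarith
  have hG1 : G 1 = 0 := by simp [G]
  have hF : ∀ x, 0 < x → HasDerivAt F (4 / 3 * G x) x := by
    intro x hx
    have := ((((hasDerivAt_id x).const_mul (2 / 3)).const_add (4 / 3)).mul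
      (hasDerivAt_klFun hx.ne')).sub (((hasDerivAt_id x).sub_const 1).pow 2)
    refine this.congr_deriv ?_
    simp only [id, G, klFun_apply]; push_cast; ring
  have hFc : Continuous F := by
    have := continuous_klFun
    fun_prop
  have hF1 : F 1 = 0 := by simp [F, klFun_one]
  suffices 0 ≤ F u by simpa [F] using this
  rw [← hF1]
  rcases le_total u 1 with h | h
  · refine antitoneOn_of_deriv_nonpos (convex_Icc 0 1) hFc.continuousOn ?_ ?_
      (Set.mem_Icc.2 ⟨hu, h⟩) (Set.mem_Icc.2 ⟨zero_le_one, le_rfl⟩) h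
    · rw [interior_Icc]
      exact fun x hx => (hF x hx.1).differentiableAt.differentiableWithinAt
    · rw [interior_Icc]
      intro x hx
      rw [(hF x hx.1).deriv]
      have := hGmono (Set.mem_Ioi.2 hx.1) (Set.mem_Ioi.2 one_pos) hx.2.le
      linarith
  · refine monotoneOn_of_deriv_nonneg (convex_Ici 1) hFc.continuousOn ?_ ?_
      (Set.mem_Ici.2 le_rfl) (Set.mem_Ici.2 h) h
    · rw [interior_Ici]
      exact fun x hx => (hF x (one_pos.trans hx)).differentiableAt.differentiableWithinAt
    · rw [interior_Ici]
      intro x hx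
      have hx0 : (0 : ℝ) < x := one_pos.trans hx
      rw [(hF x hx0).deriv]
      have := hGmono (Set.mem_Ioi.2 one_pos) (Set.mem_Ioi.2 hx0) (le_of_lt hx)
      linarith

/-- Young's inequality for the conjugate pair `klFun` and e^s - 1; it is 1 + w ≤ e^w at w = s - log
u. -/
lemma mul_le_klFun_add_exp (s : ℝ) {u : ℝ} (hu : 0 ≤ u) : s * u + 1 ≤ klFun u + exp s := by
  rcases hu.eq_or_lt with rfl | hu
  · simp [klFun_zero, (exp_pos s).le]
  · have h := add_one_le_exp (s - log u)
    rw [exp_sub, exp_log hu, le_div_iff₀ hu] at h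
    rw [klFun_apply]
    nlinarith

lemma lintegral_mul_sq_le {α : Type*} [MeasurableSpace α] {m : Measure α} {f g : α → ENNReal}
    (hf : AEMeasurable f m) (hg : AEMeasurable g m) :
    (∫⁻ x, f x * g x ∂m) ^ 2 ≤ (∫⁻ x, f x ^ 2 ∂m) * ∫⁻ x, g x ^ 2 ∂m := by
  have h := ENNReal.lintegral_mul_le_Lp_mul_Lq m Real.HolderConjugate.two_two hf hg
  simp only [Pi.mul_apply, ENNReal.rpow_two] at h
  calc _ ≤ _ := pow_le_pow_left' h 2
    _ = _ := by
      rw [mul_pow, ← ENNReal.rpow_two, ← ENNReal.rpow_two, ← ENNReal.rpow_mul, ← ENNReal.rpow_mul]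
      norm_num

variable {m n : Measure ℝ} [IsProbabilityMeasure m] {u : ℝ → ENNReal} {a L : ℝ}

lemma nonneg_of_lintegral_exp_sq_le (ha : 0 < a)
    (hexp : ∫⁻ z, ENNReal.ofReal (exp (a * z ^ 2)) ∂m ≤ ENNReal.ofReal (exp L)) : 0 ≤ L := by
  have h1 : (1 : ENNReal) ≤ ∫⁻ z, ENNReal.ofReal (exp (a * z ^ 2)) ∂m := by
    calc (1 : ENNReal) = ∫⁻ _, 1 ∂m := by simp
      _ ≤ _ := lintegral_mono fun z => by
        rw [← ENNReal.ofReal_one]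
        exact ENNReal.ofReal_le_ofReal (one_le_exp (by positivity))
  have h2 := h1.trans hexp
  rw [← ENNReal.ofReal_one, ENNReal.ofReal_le_ofReal_iff (exp_pos _).le] at h2
  exact one_le_exp_iff.1 h2

/-- The variational bound of the second moment by the relative entropy. -/
lemma lintegral_sq_le_klFun_add [IsProbabilityMeasure n] (hu : Measurable u)
    (hn : n = m.withDensity u) (ha : 0 < a)
    (hexp : ∫⁻ z, ENNReal.ofReal (exp (a * z ^ 2)) ∂m ≤ ENNReal.ofReal (exp L)) :
    ∫⁻ z, ENNReal.ofReal (a * z ^ 2) ∂n ≤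
      ∫⁻ z, ENNReal.ofReal (klFun (u z).toReal) ∂m + ENNReal.ofReal L := by
  have hL := nonneg_of_lintegral_exp_sq_le ha hexp
  have hu1 : ∫⁻ z, u z ∂m = 1 := by
    have : n Set.univ = 1 := measure_univ
    rwa [hn, withDensity_apply _ .univ, Measure.restrict_univ] at this
  have hfin : ∀ᵐ z ∂m, u z < ⊤ := ae_lt_top hu (by simp [hu1])
  have key : ∀ᵐ z ∂m, u z * ENNReal.ofReal (a * z ^ 2) + 1 ≤
      ENNReal.ofReal (klFun (u z).toReal) + (ENNReal.ofReal L * u z +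
        ENNReal.ofReal (exp (-L)) * ENNReal.ofReal (exp (a * z ^ 2))) := by
    filter_upwards [hfin] with z hz
    obtain ⟨v, hv⟩ : ∃ v : NNReal, u z = v := ⟨(u z).toNNReal, (ENNReal.coe_toNNReal hz.ne).symm⟩
    have hv0 : 0 ≤ (v : ℝ) := v.coe_nonneg
    -- The shift by L normalises the exponential: e^{-L} ∫ e^{a z²} dm ≤ 1, which cancels the 1 on
    -- the left after integration.
    have h := mul_le_klFun_add_exp (a * z ^ 2 - L) hv0
    have hk := klFun_nonneg hv0
    have h0 : (0 : ℝ) ≤ a * z ^ 2 := by positivity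
    rw [hv, ENNReal.coe_toReal, ← ENNReal.ofReal_coe_nnreal, ← ENNReal.ofReal_mul hv0,
      ← ENNReal.ofReal_one, ← ENNReal.ofReal_add (mul_nonneg hv0 h0) zero_le_one,
      ← ENNReal.ofReal_mul hL, ← ENNReal.ofReal_mul (exp_pos _).le, ← ENNReal.ofReal_add
        (mul_nonneg hL hv0) (by positivity), ← ENNReal.ofReal_add hk
        (add_nonneg (mul_nonneg hL hv0) (by positivity)), ← exp_add]
    apply ENNReal.ofReal_le_ofReal
    have e : -L + a * z ^ 2 = a * z ^ 2 - L := by ring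
    rw [e]
    nlinarith
  have hk : Measurable fun z => ENNReal.ofReal (klFun (u z).toReal) :=
    (measurable_klFun.comp hu.ennreal_toReal).ennreal_ofReal
  have h := lintegral_mono_ae key
  rw [lintegral_add_right _ measurable_const, lintegral_add_left hk,
    lintegral_add_left (hu.const_mul _), lintegral_const_mul _ hu,
    lintegral_const_mul _ (by fun_prop), hu1] at h
  simp only [lintegral_const, measure_univ, mul_one] at h
  have h3 : ENNReal.ofReal (exp (-L)) * ∫⁻ z, ENNReal.ofReal (exp (a * z ^ 2)) ∂m ≤ 1 := by
    calc _ ≤ ENNReal.ofReal (exp (-L)) * ENNReal.ofReal (exp L) := by gcongr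
      _ = 1 := by rw [← ENNReal.ofReal_mul (exp_pos _).le, ← exp_add]; simp
  have hn' : ∫⁻ z, ENNReal.ofReal (a * z ^ 2) ∂n = ∫⁻ z, u z * ENNReal.ofReal (a * z ^ 2) ∂m := by
    rw [hn, lintegral_withDensity_eq_lintegral_mul _ hu (by fun_prop)]
    rfl
  rw [hn']
  refine (ENNReal.add_le_add_iff_right ENNReal.one_ne_top).1 (h.trans ?_)
  rw [← add_assoc]
  gcongr

/-- The case of density 1, where the entropy vanishes. -/
lemma lintegral_sq_le (ha : 0 < a)
    (hexp : ∫⁻ z, ENNReal.ofReal (exp (a * z ^ 2)) ∂m ≤ ENNReal.ofReal (exp L)) :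
    ∫⁻ z, ENNReal.ofReal (a * z ^ 2) ∂m ≤ ENNReal.ofReal L := by
  simpa [klFun_one] using lintegral_sq_le_klFun_add (n := m) (u := 1) measurable_const
    (withDensity_one).symm ha hexp

/-- **Weighted Pinsker inequality** of Bolley and Villani. -/
theorem lintegral_abs_mul_abs_sub_one_le [IsProbabilityMeasure n] (hu : Measurable u)
    (hn : n = m.withDensity u) (ha : 0 < a)
    (hexp : ∫⁻ z, ENNReal.ofReal (exp (a * z ^ 2)) ∂m ≤ ENNReal.ofReal (exp L)) :
    ∫⁻ z, ENNReal.ofReal (|z| * |(u z).toReal - 1|) ∂m ≤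
      (ENNReal.ofReal (2 * ((1 + L) / a)) *
        ∫⁻ z, ENNReal.ofReal (klFun (u z).toReal) ∂m) ^ (1 / 2 : ℝ) := by
  have hL := nonneg_of_lintegral_exp_sq_le ha hexp
  have hM := lintegral_sq_le ha hexp
  have hMn := lintegral_sq_le_klFun_add hu hn ha hexp
  set H := ∫⁻ z, ENNReal.ofReal (klFun (u z).toReal) ∂m with hH
  set M := ∫⁻ z, ENNReal.ofReal (a * z ^ 2) ∂m
  set Mn := ∫⁻ z, ENNReal.ofReal (a * z ^ 2) ∂n with hMndef
  have hut : Measurable fun z => (u z).toReal := hu.ennreal_toReal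
  have hk : Measurable fun z => klFun (u z).toReal := measurable_klFun.comp hut
  have hu1 : ∫⁻ z, u z ∂m = 1 := by
    have : n Set.univ = 1 := measure_univ
    rwa [hn, withDensity_apply _ .univ, Measure.restrict_univ] at this
  have hn' : Mn = ∫⁻ z, ENNReal.ofReal (a * z ^ 2) * u z ∂m := by
    rw [hMndef, hn, lintegral_withDensity_eq_lintegral_mul _ hu (by fun_prop)]
    exact lintegral_congr fun z => mul_comm _ _
  have hweight : ∀ p q : ℝ, 0 ≤ p → 0 ≤ q →
      ∫⁻ z, ENNReal.ofReal (√(a * z ^ 2 * (p + q * (u z).toReal))) ^ 2 ∂m ≤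
        ENNReal.ofReal p * M + ENNReal.ofReal q * Mn := by
    intro p q hp hq
    rw [hn', ← lintegral_const_mul _ (by fun_prop), ← lintegral_const_mul _ (by fun_prop),
      ← lintegral_add_left (by fun_prop)]
    refine lintegral_mono fun z => ?_
    have h0 : (0 : ℝ) ≤ a * z ^ 2 := by positivity
    rw [← ENNReal.ofReal_pow (sqrt_nonneg _), sq_sqrt (by positivity), mul_add,
      ENNReal.ofReal_add (by positivity) (by positivity)]
    refine add_le_add ?_ ?_
    · rw [mul_comm, ENNReal.ofReal_mul hp]
    · rw [show a * z ^ 2 * (q * (u z).toReal) = q * ((a * z ^ 2) * (u z).toReal) by ring,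
        ENNReal.ofReal_mul hq, ENNReal.ofReal_mul h0]
      gcongr
      exact ENNReal.ofReal_toReal_le
  have hS : ENNReal.ofReal √a * ∫⁻ z, ENNReal.ofReal (|z| * |(u z).toReal - 1|) ∂m =
      ∫⁻ z, ENNReal.ofReal (√(a * z ^ 2) * |(u z).toReal - 1|) ∂m := by
    rw [← lintegral_const_mul _ (by fun_prop)]
    refine lintegral_congr fun z => ?_
    rw [← ENNReal.ofReal_mul (sqrt_nonneg _), sqrt_mul ha.le, sqrt_sq_eq_abs, mul_assoc]
  set S := ∫⁻ z, ENNReal.ofReal (|z| * |(u z).toReal - 1|) ∂m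
  have main : (ENNReal.ofReal √a * S) ^ 2 ≤ ENNReal.ofReal (2 * (1 + L)) * H := by
    rw [hS]
    have e2L : ENNReal.ofReal (2 * (1 + L)) = 2 + 2 * ENNReal.ofReal L := by
      rw [ENNReal.ofReal_mul (by norm_num), ENNReal.ofReal_add (by norm_num) hL]
      simp [mul_add]
    -- For H ≤ 3, Cauchy–Schwarz with (u-1)² ≤ (4/3 + 2u/3) klFun u leaves the weight 4/3 M + 2/3 Mn
    -- ≤ 2L + 2H/3 ≤ 2L + 2. This is where the threshold 3 comes from.
    rcases le_total H 3 with h3 | h3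
    · calc _ ≤ (∫⁻ z, ENNReal.ofReal (√(a * z ^ 2 * (4 / 3 + 2 / 3 * (u z).toReal))) *
            ENNReal.ofReal (√(klFun (u z).toReal)) ∂m) ^ 2 := by
            gcongr with z
            rw [← ENNReal.ofReal_mul (sqrt_nonneg _)]
            apply ENNReal.ofReal_le_ofReal
            rw [sqrt_mul (x := a * z ^ 2) (by positivity), mul_assoc, ← sqrt_mul (by positivity)]
            gcongr
            exact abs_le_sqrt (sq_sub_one_le_mul_klFun ENNReal.toReal_nonneg)
        _ ≤ (ENNReal.ofReal (4 / 3) * M + ENNReal.ofReal (2 / 3) * Mn) * H := by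
            refine (lintegral_mul_sq_le (by fun_prop) (by fun_prop)).trans ?_
            refine mul_le_mul' (hweight _ _ (by norm_num) (by norm_num)) (le_of_eq ?_)
            rw [hH]
            refine lintegral_congr fun z => ?_
            rw [← ENNReal.ofReal_pow (sqrt_nonneg _),
              sq_sqrt (klFun_nonneg ENNReal.toReal_nonneg)]
        _ ≤ _ := by
            gcongr
            calc _ ≤ ENNReal.ofReal (4 / 3) * ENNReal.ofReal L +
                  ENNReal.ofReal (2 / 3) * (3 + ENNReal.ofReal L) := by
                  gcongr
                  exact hMn.trans (by gcongr)
              _ = _ := by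
                have : (3 : ENNReal) = ENNReal.ofReal 3 := by simp
                rw [this, ← ENNReal.ofReal_add (by norm_num) hL,
                  ← ENNReal.ofReal_mul (by norm_num), ← ENNReal.ofReal_mul (by norm_num),
                  ← ENNReal.ofReal_add (by positivity) (by positivity)]
                congr 1; ring
    -- For large entropy the crude bound |u - 1| ≤ 1 + u suffices: it gives 2 (2L + H), which is at
    -- most 2 (1 + L) H once H ≥ 2.
    · calc _ ≤ (∫⁻ z, ENNReal.ofReal (√(a * z ^ 2 * (1 + 1 * (u z).toReal))) *
            ENNReal.ofReal (√(1 + (u z).toReal)) ∂m) ^ 2 := by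
            gcongr with z
            rw [← ENNReal.ofReal_mul (sqrt_nonneg _)]
            apply ENNReal.ofReal_le_ofReal
            have : (0 : ℝ) ≤ (u z).toReal := ENNReal.toReal_nonneg
            rw [sqrt_mul (x := a * z ^ 2) (by positivity), mul_assoc, one_mul, mul_self_sqrt (by positivity)]
            gcongr
            rw [abs_le]; constructor <;> linarith
        _ ≤ (ENNReal.ofReal 1 * M + ENNReal.ofReal 1 * Mn) * 2 := by
            refine (lintegral_mul_sq_le (by fun_prop) (by fun_prop)).trans ?_
            refine mul_le_mul' (hweight _ _ (by norm_num) (by norm_num)) ?_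
            calc _ ≤ ∫⁻ z, (1 + u z) ∂m := by
                  refine lintegral_mono fun z => ?_
                  rw [← ENNReal.ofReal_pow (sqrt_nonneg _), sq_sqrt (by positivity),
                    ENNReal.ofReal_add (by positivity) (by positivity), ENNReal.ofReal_one]
                  gcongr
                  exact ENNReal.ofReal_toReal_le
              _ = 2 := by
                  rw [lintegral_add_left measurable_const, hu1]
                  simp [one_add_one_eq_two]
        _ ≤ (2 * ENNReal.ofReal L + H) * 2 := by
            rw [ENNReal.ofReal_one, one_mul, one_mul, two_mul, add_assoc, add_comm _ H]
            gcongr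
        _ ≤ _ := by
            rw [e2L]
            have : (2 : ENNReal) ≤ H := le_trans (by norm_num) h3
            calc (2 * ENNReal.ofReal L + H) * 2 = 2 * ENNReal.ofReal L * 2 + 2 * H := by ring
              _ ≤ 2 * ENNReal.ofReal L * H + 2 * H := by gcongr
              _ = _ := by ring
  rw [mul_pow, ← ENNReal.ofReal_pow (sqrt_nonneg _), sq_sqrt ha.le] at main
  have h1 : S ^ 2 ≤ ENNReal.ofReal (2 * ((1 + L) / a)) * H := by
    have ha' : ENNReal.ofReal a ≠ 0 := by simpa using ha
    rw [← ENNReal.mul_le_mul_iff_right ha' ENNReal.ofReal_ne_top, ← mul_assoc,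
      ← ENNReal.ofReal_mul ha.le]
    convert main using 3
    field_simp
  calc S = (S ^ 2) ^ (1 / 2 : ℝ) := by
        rw [← ENNReal.rpow_two, ← ENNReal.rpow_mul]; norm_num
    _ ≤ _ := by gcongr

end WeightedPinsker

/-! ### Lipschitz test functions and the quantile coupling -/

section LipschitzTest

open InformationTheory Real

lemma LipschitzWith.abs_sub_le_abs_sub {f : ℝ → ℝ} (hf : LipschitzWith 1 f) (x y : ℝ) :
    |f x - f y| ≤ |x - y| := by
  simpa [Real.dist_eq] using hf.dist_le_mul x y

lemma LipschitzWith.integrable_of_integrable_id {m : Measure ℝ} [IsFiniteMeasure m]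
    (hm : Integrable id m) {f : ℝ → ℝ} (hf : LipschitzWith 1 f) : Integrable f m := by
  refine Integrable.mono' ((integrable_const |f 0|).add hm.abs)
    hf.continuous.aestronglyMeasurable (.of_forall fun z => ?_)
  have := hf.abs_sub_le_abs_sub z 0
  simp only [sub_zero] at this
  have h2 := abs_sub_abs_le_abs_sub (f z) (f 0)
  simp only [Real.norm_eq_abs, Pi.add_apply, id]
  linarith

lemma integrable_id_of_lintegral_sq_ne_top {m : Measure ℝ} [IsFiniteMeasure m] {a : ℝ} (ha : 0 < a)
    (h : ∫⁻ z, ENNReal.ofReal (a * z ^ 2) ∂m ≠ ⊤) : Integrable id m := by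
  have h2 : Integrable (fun z : ℝ => a * z ^ 2) m :=
    (lintegral_ofReal_ne_top_iff_integrable (by fun_prop) (.of_forall fun z => by positivity)).1 h
  refine Integrable.mono' ((integrable_const 1).add (h2.const_mul a⁻¹))
    measurable_id.aestronglyMeasurable (.of_forall fun z => ?_)
  simp only [Real.norm_eq_abs, Pi.add_apply, id, ← mul_assoc, inv_mul_cancel₀ ha.ne', one_mul]
  nlinarith [sq_abs z, sq_nonneg (|z| - 1), abs_nonneg z]

variable {m n : Measure ℝ} [IsProbabilityMeasure m] [IsProbabilityMeasure n]
  {u : ℝ → ENNReal} {a L : ℝ}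

lemma integrable_id_of_lintegral_exp_sq_le (ha : 0 < a)
    (hexp : ∫⁻ z, ENNReal.ofReal (exp (a * z ^ 2)) ∂m ≤ ENNReal.ofReal (exp L)) :
    Integrable id m :=
  integrable_id_of_lintegral_sq_ne_top ha
    (ne_top_of_le_ne_top ENNReal.ofReal_ne_top (lintegral_sq_le ha hexp))

lemma integrable_id_withDensity (hu : Measurable u) (hn : n = m.withDensity u) (ha : 0 < a)
    (hexp : ∫⁻ z, ENNReal.ofReal (exp (a * z ^ 2)) ∂m ≤ ENNReal.ofReal (exp L))
    (hk : ∫⁻ z, ENNReal.ofReal (klFun (u z).toReal) ∂m ≠ ⊤) :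
    Integrable id n :=
  integrable_id_of_lintegral_sq_ne_top ha
    (ne_top_of_le_ne_top (ENNReal.add_ne_top.2 ⟨hk, ENNReal.ofReal_ne_top⟩)
      (lintegral_sq_le_klFun_add hu hn ha hexp))

/-- Transport-entropy inequality in dual form. -/
lemma ofReal_integral_sub_le (hu : Measurable u) (hn : n = m.withDensity u) (ha : 0 < a)
    (hexp : ∫⁻ z, ENNReal.ofReal (exp (a * z ^ 2)) ∂m ≤ ENNReal.ofReal (exp L))
    (hk : ∫⁻ z, ENNReal.ofReal (klFun (u z).toReal) ∂m ≠ ⊤)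
    {f : ℝ → ℝ} (hf : LipschitzWith 1 f) :
    ENNReal.ofReal (∫ z, f z ∂m - ∫ z, f z ∂n) ≤
      (ENNReal.ofReal (2 * ((1 + L) / a)) *
        ∫⁻ z, ENNReal.ofReal (klFun (u z).toReal) ∂m) ^ (1 / 2 : ℝ) := by
  have hm := integrable_id_of_lintegral_exp_sq_le ha hexp
  have hn1 := integrable_id_withDensity hu hn ha hexp hk
  have hfm := hf.integrable_of_integrable_id hm
  have hfn := hf.integrable_of_integrable_id hn1
  have hu1 : ∫⁻ z, u z ∂m = 1 := by
    have : n Set.univ = 1 := measure_univ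
    rwa [hn, withDensity_apply _ .univ, Measure.restrict_univ] at this
  have hfin : ∀ᵐ z ∂m, u z < ⊤ := ae_lt_top hu (by simp [hu1])
  -- Both laws have mass one, so subtracting f 0 does not change the gap, and it gives |g z| ≤ |z|,
  -- the weight in Pinsker's inequality.
  let g : ℝ → ℝ := fun z => f z - f 0
  have hgm : Integrable g m := hfm.sub (integrable_const _)
  have hgn : Integrable g n := hfn.sub (integrable_const _)
  have e1 : ∫ z, f z ∂m - ∫ z, f z ∂n = ∫ z, g z ∂m - ∫ z, g z ∂n := by
    simp only [g]
    rw [integral_sub hfm (integrable_const _), integral_sub hfn (integrable_const _)]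
    simp
  have hgu : Integrable (fun z => (u z).toReal • g z) m := by
    rw [hn] at hgn
    exact (integrable_withDensity_iff_integrable_smul' hu hfin).1 hgn
  have e2 : ∫ z, g z ∂n = ∫ z, (u z).toReal • g z ∂m := by
    rw [hn]
    exact integral_withDensity_eq_integral_toReal_smul hu hfin _
  rw [e1, e2, ← integral_sub hgm hgu]
  refine le_trans ?_ (lintegral_abs_mul_abs_sub_one_le hu hn ha hexp)
  calc _ ≤ ENNReal.ofReal |∫ z, (g z - (u z).toReal • g z) ∂m| :=
        ENNReal.ofReal_le_ofReal (le_abs_self _)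
    _ = ‖∫ z, (g z - (u z).toReal • g z) ∂m‖ₑ := by
        rw [← Real.norm_eq_abs, ofReal_norm]
    _ ≤ ∫⁻ z, ‖g z - (u z).toReal • g z‖ₑ ∂m := enorm_integral_le_lintegral_enorm _
    _ ≤ _ := by
      refine lintegral_mono fun z => ?_
      rw [← ofReal_norm]
      apply ENNReal.ofReal_le_ofReal
      have h : g z - (u z).toReal • g z = g z * (1 - (u z).toReal) := by
        simp only [smul_eq_mul]; ring
      rw [h, Real.norm_eq_abs, abs_mul, abs_sub_comm 1]
      exact mul_le_mul_of_nonneg_right (by simpa using hf.abs_sub_le_abs_sub z 0) (abs_nonneg _)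

end LipschitzTest

/-! ### Quantile functions and the monotone coupling on the line -/

section Quantile

open Set

/-- The uniform law on `(0, 1)`. -/
noncomputable def unitLaw : Measure ℝ := volume.restrict (Ioo 0 1)

instance : IsProbabilityMeasure unitLaw := ⟨by simp [unitLaw]⟩

lemma ae_unitLaw : ∀ᵐ s ∂unitLaw, s ∈ Ioo (0 : ℝ) 1 := ae_restrict_mem measurableSet_Ioo

/-- The quantile function of a law on `ℝ`, set to zero outside `(0, 1)`. -/
noncomputable def quantile (m : Measure ℝ) (s : ℝ) : ℝ :=
  if s ∈ Ioo (0 : ℝ) 1 then sInf {w | s ≤ cdf m w} else 0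

/-- Right continuity of the cdf makes the infimum attained. The restriction to (0, 1) makes the set
nonempty and bounded below. -/
lemma quantile_le_iff (m : Measure ℝ) {s : ℝ} (hs : s ∈ Ioo (0 : ℝ) 1) (w : ℝ) :
    quantile m s ≤ w ↔ s ≤ cdf m w := by
  rw [quantile, if_pos hs]
  have hbdd : BddBelow {w | s ≤ cdf m w} := by
    obtain ⟨b, hb⟩ := ((tendsto_cdf_atBot m).eventually_lt_const hs.1).exists
    refine ⟨b, fun w hw => ?_⟩
    by_contra! hlt
    exact absurd (hw.trans (monotone_cdf m hlt.le)) (not_le.2 hb)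
  have hne : {w | s ≤ cdf m w}.Nonempty := by
    obtain ⟨b, hb⟩ := ((tendsto_cdf_atTop m).eventually_const_lt hs.2).exists
    exact ⟨b, hb.le⟩
  refine ⟨fun h => ?_, fun h => csInf_le hbdd h⟩
  have hgt : ∀ w' ∈ Ioi w, s ≤ cdf m w' := by
    intro w' hw'
    obtain ⟨v, hv, hvw⟩ := exists_lt_of_csInf_lt hne (h.trans_lt hw')
    exact le_trans hv (monotone_cdf m hvw.le)
  have hcont : Filter.Tendsto (cdf m) (nhdsWithin w (Ioi w)) (nhds (cdf m w)) :=
    ((cdf m).right_continuous w).mono_left (nhdsWithin_mono _ Ioi_subset_Ici_self)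
  exact ge_of_tendsto hcont (eventually_nhdsWithin_of_forall hgt)

lemma measurable_quantile {α : Type*} [MeasurableSpace α] (κ : Kernel α ℝ) [IsMarkovKernel κ] :
    Measurable fun p : α × ℝ => quantile (κ p.1) p.2 := by
  refine measurable_of_Iic fun w => ?_
  have hS : MeasurableSet {p : α × ℝ | p.2 ∈ Ioo (0 : ℝ) 1} := measurable_snd measurableSet_Ioo
  have hF : Measurable fun p : α × ℝ => cdf (κ p.1) w := by
    simp only [cdf_eq_real, measureReal_def]
    exact ((κ.measurable_coe measurableSet_Iic).comp measurable_fst).ennreal_toReal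
  have : (fun p : α × ℝ => quantile (κ p.1) p.2) ⁻¹' Iic w =
      ({p : α × ℝ | p.2 ∈ Ioo (0 : ℝ) 1} ∩ {p | p.2 ≤ cdf (κ p.1) w}) ∪
        ({p : α × ℝ | p.2 ∈ Ioo (0 : ℝ) 1}ᶜ ∩ {_p | (0 : ℝ) ≤ w}) := by
    ext p
    by_cases hp : p.2 ∈ Ioo (0 : ℝ) 1
    · have := quantile_le_iff (κ p.1) hp w
      simp only [mem_preimage, mem_Iic, this, mem_union, mem_inter_iff, mem_ofPred_eq,
        mem_compl_iff, hp, true_and, not_true_eq_false, false_and, or_false]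
    · simp only [mem_preimage, mem_Iic, quantile, if_false, mem_union, mem_inter_iff,
        mem_ofPred_eq, mem_compl_iff, hp, false_and, not_false_eq_true, true_and, false_or]
  rw [this]
  exact (hS.inter (measurableSet_le measurable_snd hF)).union (hS.compl.inter (.const _))

lemma measurable_quantile_right (m : Measure ℝ) [IsProbabilityMeasure m] :
    Measurable (quantile m) :=
  (measurable_quantile (Kernel.const Unit m)).comp (measurable_prodMk_left (x := ()))

lemma map_quantile (m : Measure ℝ) [IsProbabilityMeasure m] :
    unitLaw.map (quantile m) = m := by
  have := Measure.isProbabilityMeasure_map (μ := unitLaw) (measurable_quantile_right m).aemeasurable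
  refine Measure.ext_of_Iic _ _ fun w => ?_
  rw [Measure.map_apply (measurable_quantile_right m) measurableSet_Iic, unitLaw,
    Measure.restrict_apply (measurable_quantile_right m measurableSet_Iic)]
  have h : quantile m ⁻¹' Iic w ∩ Ioo 0 1 = Iic (cdf m w) ∩ Ioo 0 1 := by
    ext s
    simp only [mem_inter_iff, mem_preimage, mem_Iic, and_congr_left_iff]
    exact fun hs => quantile_le_iff m hs w
  rw [h, ← Measure.restrict_apply measurableSet_Iic, restrict_Ioo_eq_restrict_Ioc,
    Measure.restrict_apply measurableSet_Iic, inter_comm, ← Ioi_inter_Iic, inter_assoc,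
    Iic_inter_Iic, min_eq_right (cdf_le_one m w), Ioi_inter_Iic, Real.volume_Ioc, sub_zero,
    ofReal_cdf]

/-- Kantorovich-Rubinstein bound for the quantile coupling. -/
theorem lintegral_quantile_sub_le {p q : Measure ℝ} [IsProbabilityMeasure p]
    [IsProbabilityMeasure q] (hp : Integrable id p) (hq : Integrable id q) {D : ENNReal}
    (hD : ∀ f : ℝ → ℝ, LipschitzWith 1 f → ENNReal.ofReal (∫ z, f z ∂p - ∫ z, f z ∂q) ≤ D) :
    ∫⁻ s, ENNReal.ofReal |quantile p s - quantile q s| ∂unitLaw ≤ D := by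
  classical
  -- S is the derivative of a potential f that is optimal for every level s at once: between the two
  -- quantiles at level s, the cdfs lie on opposite sides of s, so S has constant sign there.
  let S : ℝ → ℝ := fun w => if cdf p w < cdf q w then 1 else -1
  have hSm : Measurable S :=
    Measurable.ite (measurableSet_lt (monotone_cdf p).measurable (monotone_cdf q).measurable)
      measurable_const measurable_const
  have hS1 : ∀ w, ‖S w‖ ≤ 1 := by
    intro w; simp only [S]; split_ifs <;> simp
  have hSi : ∀ x y, IntervalIntegrable S volume x y := fun x y =>
    (intervalIntegrable_const (c := (1 : ℝ))).mono_fun hSm.aestronglyMeasurable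
      (.of_forall fun w => by simpa using hS1 w)
  let f : ℝ → ℝ := fun z => ∫ w in (0 : ℝ)..z, S w
  have hfsub : ∀ x y, f x - f y = ∫ w in y..x, S w := fun x y =>
    intervalIntegral.integral_interval_sub_left (hSi _ _) (hSi _ _)
  have hf : LipschitzWith 1 f := LipschitzWith.of_dist_le_mul fun x y => by
    rw [Real.dist_eq, hfsub, Real.dist_eq, NNReal.coe_one]
    exact intervalIntegral.norm_integral_le_of_norm_le_const fun w _ => hS1 w
  have hkey : ∀ᵐ s ∂unitLaw, |quantile p s - quantile q s| =
      f (quantile p s) - f (quantile q s) := by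
    filter_upwards [ae_unitLaw] with s hs
    rw [hfsub]
    rcases le_total (quantile q s) (quantile p s) with h | h
    · have : ∫ w in quantile q s..quantile p s, S w = ∫ w in quantile q s..quantile p s, 1 := by
        -- The right endpoint is discarded as a null set: at w = quantile p s one has cdf p w ≥ s,
        -- so the sign of S is not controlled there.
        refine intervalIntegral.integral_congr_ae ?_
        have hne : ∀ᵐ w : ℝ, w ≠ quantile p s := by simp [ae_iff]
        filter_upwards [hne] with w hw hmem
        rw [uIoc_of_le h] at hmem
        have h1 : s ≤ cdf q w := (quantile_le_iff q hs w).1 hmem.1.le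
        have h2 : cdf p w < s := by
          rw [← not_le, ← quantile_le_iff p hs w, not_le]
          exact lt_of_le_of_ne hmem.2 hw
        simp only [S, if_pos (h2.trans_le h1)]
      rw [this, intervalIntegral.integral_const, smul_eq_mul, mul_one,
        abs_of_nonneg (sub_nonneg.2 h)]
    · rw [intervalIntegral.integral_symm]
      have : ∫ w in quantile p s..quantile q s, S w = ∫ w in quantile p s..quantile q s, (-1) := by
        refine intervalIntegral.integral_congr_ae ?_
        have hne : ∀ᵐ w : ℝ, w ≠ quantile q s := by simp [ae_iff]
        filter_upwards [hne] with w hw hmem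
        rw [uIoc_of_le h] at hmem
        have h1 : s ≤ cdf p w := (quantile_le_iff p hs w).1 hmem.1.le
        have h2 : cdf q w < s := by
          rw [← not_le, ← quantile_le_iff q hs w, not_le]
          exact lt_of_le_of_ne hmem.2 hw
        simp only [S, if_neg (not_lt.2 (h2.le.trans h1))]
      rw [this, intervalIntegral.integral_const, smul_eq_mul,
        abs_of_nonpos (sub_nonpos.2 h)]
      ring
  have hfp := hf.integrable_of_integrable_id hp
  have hfq := hf.integrable_of_integrable_id hq
  have hmp := measurable_quantile_right p
  have hmq := measurable_quantile_right q
  have hip : Integrable (fun s => f (quantile p s)) unitLaw := by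
    rw [← map_quantile p] at hfp
    exact hfp.comp_measurable hmp
  have hiq : Integrable (fun s => f (quantile q s)) unitLaw := by
    rw [← map_quantile q] at hfq
    exact hfq.comp_measurable hmq
  have hint : ∫ s, (f (quantile p s) - f (quantile q s)) ∂unitLaw =
      ∫ z, f z ∂p - ∫ z, f z ∂q := by
    rw [integral_sub hip hiq]
    congr 1
    · conv_rhs => rw [← map_quantile p]
      rw [integral_map hmp.aemeasurable hf.continuous.aestronglyMeasurable]
    · conv_rhs => rw [← map_quantile q]
      rw [integral_map hmq.aemeasurable hf.continuous.aestronglyMeasurable]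
  refine le_trans (le_of_eq ?_) (hD f hf)
  rw [← hint, ofReal_integral_eq_lintegral_ofReal (f := fun s => f (quantile p s) - f (quantile q s))
    (hip.sub hiq)]
  · exact lintegral_congr_ae (hkey.mono fun s hs => by simp only [hs])
  · filter_upwards [hkey] with s hs
    exact hs ▸ abs_nonneg _

end Quantile

/-! ### One null set for all Lipschitz test functions -/

section LipschitzKernel

/-- A Lipschitz bound for the averages of each Lipschitz test function along a kernel, valid
outside a null set depending on the test function, holds outside a common null set. -/
theorem exists_ae_forall_lipschitz_le {α : Type*} [MeasurableSpace α] {μ : Measure α}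
    {κ : Kernel α ℝ} [IsMarkovKernel κ] {d : α → α → ℝ} (hκ : ∀ᵐ x ∂μ, Integrable id (κ x))
    (hlip : ∀ f : ℝ → ℝ, LipschitzWith 1 f → ∃ g : α → ℝ, (∀ p q, |g p - g q| ≤ d p q) ∧
      ∀ᵐ x ∂μ, ∫ z, f z ∂(κ x) = g x) :
    ∃ G : Set α, (∀ᵐ x ∂μ, x ∈ G) ∧ ∀ p ∈ G, ∀ q ∈ G, ∀ f : ℝ → ℝ, LipschitzWith 1 f →
      ∫ z, f z ∂(κ p) - ∫ z, f z ∂(κ q) ≤ d p q := by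
  let T : Set C(ℝ, ℝ) := {f | LipschitzWith 1 f}
  -- The 1-Lipschitz functions are separable for locally uniform convergence, so countably many null
  -- sets suffice. Pointwise limits then pass under the integral, dominated by B + |z|.
  obtain ⟨D, hDc, hDd⟩ := TopologicalSpace.exists_countable_dense T
  have hDlip : ∀ f : T, LipschitzWith 1 (f : C(ℝ, ℝ)) := fun f => f.2
  choose! g hg hgae using hlip
  have : ∀ᵐ x ∂μ, ∀ f ∈ D, ∫ z, (f : C(ℝ, ℝ)) z ∂(κ x) = g (f : C(ℝ, ℝ)) x := by
    rw [ae_ball_iff hDc]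
    exact fun f _ => hgae _ (hDlip f)
  refine ⟨_, hκ.and this, ?_⟩
  rintro p ⟨hp, hpD⟩ q ⟨hq, hqD⟩ f hf
  have hfD : (⟨⟨f, hf.continuous⟩, hf⟩ : T) ∈ closure D := hDd _
  obtain ⟨F, hFD, hF⟩ := mem_closure_iff_seq_limit.1 hfD
  have hF' : Filter.Tendsto (fun n => (F n : C(ℝ, ℝ))) Filter.atTop
      (nhds (⟨f, hf.continuous⟩ : C(ℝ, ℝ))) := (continuous_subtype_val.tendsto _).comp hF
  have hpt : ∀ z, Filter.Tendsto (fun n => (F n : C(ℝ, ℝ)) z) Filter.atTop (nhds (f z)) :=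
    fun z => ((continuous_eval_const z).tendsto _).comp hF'
  obtain ⟨B, hB⟩ := (hpt 0).abs.bddAbove_range
  have hconv : ∀ m : Measure ℝ, IsProbabilityMeasure m → Integrable id m →
      Filter.Tendsto (fun n => ∫ z, (F n : C(ℝ, ℝ)) z ∂m) Filter.atTop (nhds (∫ z, f z ∂m)) := by
    intro m _ hm
    refine tendsto_integral_of_dominated_convergence (fun z => B + |z|)
      (fun n => (F n : C(ℝ, ℝ)).continuous.aestronglyMeasurable)
      ((integrable_const B).add hm.abs) (fun n => .of_forall fun z => ?_)
      (.of_forall hpt)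
    have h1 : |(F n : C(ℝ, ℝ)) 0| ≤ B := hB ⟨n, rfl⟩
    have h2 := (hDlip (F n)).abs_sub_le_abs_sub z 0
    have h3 := abs_sub_abs_le_abs_sub ((F n : C(ℝ, ℝ)) z) ((F n : C(ℝ, ℝ)) 0)
    rw [sub_zero] at h2
    rw [Real.norm_eq_abs]
    linarith
  refine le_of_tendsto ((hconv _ inferInstance hp).sub (hconv _ inferInstance hq))
    (.of_forall fun n => ?_)
  rw [hpD _ (hFD n), hqD _ (hFD n)]
  exact (le_abs_self _).trans (hg _ (hDlip (F n)) p q)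

end LipschitzKernel

/-! ### Transport plans driven by independent noise -/

section NoiseTransport

lemma measurable_initSeg {N k : ℕ} (hk : k ≤ N) : Measurable (initSeg k hk) :=
  measurable_pi_lambda _ fun _ => measurable_pi_apply _

lemma measurable_l1Dist {k : ℕ} :
    Measurable fun p : (Fin k → ℝ) × (Fin k → ℝ) => l1Dist p.1 p.2 := by
  unfold l1Dist
  fun_prop

lemma l1Dist_comm {k : ℕ} (x y : Fin k → ℝ) : l1Dist x y = l1Dist y x := by
  simp only [l1Dist, abs_sub_comm]

lemma l1Dist_nonneg {k : ℕ} (x y : Fin k → ℝ) : 0 ≤ l1Dist x y :=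
  Finset.sum_nonneg fun _ _ => abs_nonneg _

/-- Extension of a finite sequence by zeros. -/
def padZero {k : ℕ} (N : ℕ) (p : Fin k → ℝ) : Fin N → ℝ :=
  fun i => if h : (i : ℕ) < k then p ⟨i, h⟩ else 0

lemma measurable_padZero {k N : ℕ} : Measurable (padZero N : (Fin k → ℝ) → Fin N → ℝ) := by
  refine measurable_pi_lambda _ fun i => ?_
  unfold padZero
  by_cases h : (i : ℕ) < k
  · simpa only [h, dif_pos] using measurable_pi_apply _
  · simp only [h, dif_neg, not_false_eq_true, measurable_const]

lemma padZero_initSeg_apply {k N : ℕ} (hk : k ≤ N) (x : Fin N → ℝ) {i : Fin N}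
    (hi : (i : ℕ) < k) : padZero N (initSeg k hk x) i = x i := by
  simp [padZero, hi, initSeg]

/-- A map producing paths from paths and noise is adapted if the output up to time `t` only
depends on the noise and on the input path up to time `t`. -/
def IsAdaptedMap {N : ℕ} {Ω : Type*} (Φ : (Fin N → ℝ) × Ω → Fin N → ℝ) : Prop :=
  ∀ (t : Fin N) (x x' : Fin N → ℝ) (ω : Ω), (∀ i ≤ t, x i = x' i) → Φ (x, ω) t = Φ (x', ω) t

/-- Coordinates not yet seen may be overwritten by zeros. This turns functions of the whole path
into Borel functions of its initial segment. -/
lemma IsAdaptedMap.initSeg_padZero {N : ℕ} {Ω : Type*} {Φ : (Fin N → ℝ) × Ω → Fin N → ℝ}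
    (hΦ : IsAdaptedMap Φ) (k : ℕ) (hk : k ≤ N) (x : Fin N → ℝ) (ω : Ω) :
    initSeg k hk (Φ (padZero N (initSeg k hk x), ω)) = initSeg k hk (Φ (x, ω)) := by
  funext i
  refine hΦ _ _ _ _ fun j hj => padZero_initSeg_apply hk x ?_
  have : (j : ℕ) ≤ i := hj
  omega

/-- The plan `γ` is the law of `(x, Φ (x, ω))`, where `x` has law `μ`, the noise `ω` is independent
of `x` and `Φ` is adapted. -/
def IsNoiseTransport {N : ℕ} (μ : Measure (Fin N → ℝ))
    (γ : Measure ((Fin N → ℝ) × (Fin N → ℝ))) : Prop :=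
  ∃ (Ω : Type) (_ : MeasurableSpace Ω) (P : Measure Ω) (_ : IsProbabilityMeasure P)
    (Φ : (Fin N → ℝ) × Ω → Fin N → ℝ), Measurable Φ ∧ IsAdaptedMap Φ ∧
      γ = (μ.prod P).map fun z => (z.1, Φ z)

/-- The noise is itself the ν-sample, and Φ ignores x. -/
lemma isNoiseTransport_prod {N : ℕ} (μ ν : Measure (Fin N → ℝ)) [IsProbabilityMeasure ν] :
    IsNoiseTransport μ (μ.prod ν) :=
  ⟨Fin N → ℝ, inferInstance, ν, inferInstance, Prod.snd, measurable_snd, fun _ _ _ _ _ => rfl,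
    Measure.map_id.symm⟩

variable {N : ℕ} {μ ν : Measure (Fin N → ℝ)} {γ : Measure ((Fin N → ℝ) × (Fin N → ℝ))}

lemma IsNoiseTransport.map_fst (h : IsNoiseTransport μ γ) : γ.map Prod.fst = μ := by
  obtain ⟨Ω, _, P, _, Φ, hΦ, -, rfl⟩ := h
  rw [Measure.map_map measurable_fst (measurable_fst.prodMk hΦ)]
  exact Measure.fst_prod

/-- By uniqueness of disintegrations γ^x is the law of Φ(x, ω). The probability of an event in F_t
therefore depends only on the first t coordinates of x. -/
lemma IsNoiseTransport.isCausalPlan [IsProbabilityMeasure μ] [IsFiniteMeasure γ]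
    (h : IsNoiseTransport μ γ) (hsnd : γ.map Prod.snd = ν) :
    IsCausalPlan μ ν γ := by
  have hfst := h.map_fst
  obtain ⟨Ω, _, P, _, Φ, hΦ, had, hγ⟩ := h
  refine ⟨hfst, hsnd, ?_⟩
  let κ : Kernel (Fin N → ℝ) (Fin N → ℝ) := (Kernel.id ×ₖ Kernel.const _ P).map Φ
  have : IsMarkovKernel κ := Kernel.IsMarkovKernel.map _ hΦ
  have hκ : ∀ x B, MeasurableSet B → κ x B = P {ω | Φ (x, ω) ∈ B} := by
    intro x B hB
    rw [Kernel.map_apply' _ hΦ _ hB, Kernel.prod_apply, Kernel.id_apply, Kernel.const_apply,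
      Measure.dirac_prod, Measure.map_apply measurable_prodMk_left (hΦ hB)]
    rfl
  have hcomp : γ = μ ⊗ₘ κ := by
    ext s hs
    rw [Measure.compProd_apply hs, hγ, Measure.map_apply (by fun_prop) hs,
      Measure.prod_apply ((measurable_fst.prodMk hΦ) hs)]
    refine lintegral_congr fun x => ?_
    rw [hκ _ _ (measurable_prodMk_left hs)]
    rfl
  have hfst' : γ.fst = μ := hfst
  have hae := eq_condKernel_of_measure_eq_compProd κ (ρ := γ) (by rw [hfst', ← hcomp])
  rw [hfst'] at hae
  rintro t B ⟨B', hB', rfl⟩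
  have hBm : MeasurableSet (initSeg (t + 1) t.isLt ⁻¹' B') :=
    measurable_initSeg t.isLt hB'
  let G : (Fin (t + 1) → ℝ) → ENNReal := fun p => κ (padZero N p) (initSeg (t + 1) t.isLt ⁻¹' B')
  have hG : Measurable G := (κ.measurable_coe hBm).comp measurable_padZero
  refine ⟨fun x => G (initSeg (t + 1) t.isLt x), hG.comp (comap_measurable _), ?_⟩
  filter_upwards [hae] with x hx
  rw [← hx, hκ _ _ hBm]
  simp only [G]
  rw [hκ _ _ hBm]
  simp only [Set.mem_preimage, had.initSeg_padZero]

/-- An adapted control applied along a path. -/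
def controlPath (u : (t : Fin N) → (Fin (t + 1) → ℝ) → ℝ) (x : Fin N → ℝ) : Fin N → ℝ :=
  fun t => u t (initSeg (t + 1) t.isLt x)

lemma measurable_controlPath {u : (t : Fin N) → (Fin (t + 1) → ℝ) → ℝ}
    (hu : u ∈ adaptedControls N) : Measurable (controlPath u) :=
  measurable_pi_lambda _ fun t => (hu t).comp (measurable_initSeg t.isLt)

/-- Controls may be transferred along a noise transport, since randomising a control does not
improve it. -/
theorem IsNoiseTransport.iInf_lintegral_le [IsProbabilityMeasure μ]
    (h : IsNoiseTransport μ γ) (hsnd : γ.map Prod.snd = ν)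
    {H : (Fin N → ℝ) → (Fin N → ℝ) → ℝ} (hH : Measurable fun p : _ × _ => H p.1 p.2) {r : NNReal}
    (hlip : ∀ x x' u, |H x u - H x' u| ≤ r * l1Dist x x') {b : ℝ}
    {u : (t : Fin N) → (Fin (t + 1) → ℝ) → ℝ} (hu : u ∈ adaptedControls N) :
    ⨅ w ∈ adaptedControls N, ∫⁻ x, ENNReal.ofReal (H x (controlPath w x) - b) ∂μ ≤
      ∫⁻ x, ENNReal.ofReal (H x (controlPath u x) - b) ∂ν +
        r * ∫⁻ p, ENNReal.ofReal (l1Dist p.1 p.2) ∂γ := by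
  have hum := measurable_controlPath hu
  have hF : Measurable fun p : (Fin N → ℝ) × (Fin N → ℝ) =>
      ENNReal.ofReal (H p.1 (controlPath u p.2) - b) :=
    ((hH.comp (measurable_fst.prodMk (hum.comp measurable_snd))).sub_const b).ennreal_ofReal
  have hFd : Measurable fun x : Fin N → ℝ => ENNReal.ofReal (H x (controlPath u x) - b) :=
    hF.comp (measurable_id.prodMk measurable_id)
  have hFs : Measurable fun p : (Fin N → ℝ) × (Fin N → ℝ) =>
      ENNReal.ofReal (H p.2 (controlPath u p.2) - b) := hFd.comp measurable_snd
  -- Only the first argument of H moves from y to x; the control is still read along y.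
  have h1 : ∫⁻ p, ENNReal.ofReal (H p.1 (controlPath u p.2) - b) ∂γ ≤
      ∫⁻ x, ENNReal.ofReal (H x (controlPath u x) - b) ∂ν +
        r * ∫⁻ p, ENNReal.ofReal (l1Dist p.1 p.2) ∂γ := by
    rw [← hsnd, lintegral_map hFd measurable_snd,
      ← lintegral_const_mul _ measurable_l1Dist.ennreal_ofReal,
      ← lintegral_add_left hFs]
    refine lintegral_mono fun p => ?_
    have := (le_abs_self _).trans (hlip p.1 p.2 (controlPath u p.2))
    calc _ ≤ ENNReal.ofReal ((H p.2 (controlPath u p.2) - b) + r * l1Dist p.1 p.2) :=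
          ENNReal.ofReal_le_ofReal (by linarith)
      _ ≤ _ := ENNReal.ofReal_add_le
      _ = _ := by rw [ENNReal.ofReal_mul r.coe_nonneg, ENNReal.ofReal_coe_nnreal]
  refine le_trans ?_ h1
  obtain ⟨Ω, _, P, _, Φ, hΦ, had, rfl⟩ := h
  have hFΦ : Measurable fun z : (Fin N → ℝ) × Ω =>
      ENNReal.ofReal (H z.1 (controlPath u (Φ z)) - b) := hF.comp (measurable_fst.prodMk hΦ)
  rw [lintegral_map hF (measurable_fst.prodMk hΦ), lintegral_prod_symm' _ hFΦ]
  calc _ = ∫⁻ _, (⨅ w ∈ adaptedControls N,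
        ∫⁻ x, ENNReal.ofReal (H x (controlPath w x) - b) ∂μ) ∂P := by simp
    _ ≤ _ := by
      refine lintegral_mono fun ω => ?_
      -- With ω frozen, u read along Φ(·, ω) is a deterministic adapted control, hence a competitor
      -- for μ.
      let w : (t : Fin N) → (Fin (t + 1) → ℝ) → ℝ := fun t p =>
        u t (initSeg (t + 1) t.isLt (Φ (padZero N p, ω)))
      have hw : w ∈ adaptedControls N := fun t => (hu t).comp
        ((measurable_initSeg t.isLt).comp (hΦ.comp (measurable_padZero.prodMk measurable_const)))
      refine (iInf₂_le w hw).trans (le_of_eq (lintegral_congr fun x => ?_))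
      have : controlPath w x = controlPath u (Φ (x, ω)) := by
        funext t
        simp only [controlPath, w, had.initSeg_padZero]
      simp only [this]

end NoiseTransport

/-! ### Extension of plans by one time step -/

section Extension

variable {n : ℕ}

/-- Appending one coordinate to a path. -/
def snocPath (p : (Fin n → ℝ) × ℝ) : Fin (n + 1) → ℝ := Fin.snoc (α := fun _ => ℝ) p.1 p.2

@[simp] lemma snocPath_castSucc (p : (Fin n → ℝ) × ℝ) (i : Fin n) :
    snocPath p i.castSucc = p.1 i := Fin.snoc_castSucc (α := fun _ => ℝ) ..

@[simp] lemma snocPath_last (p : (Fin n → ℝ) × ℝ) : snocPath p (Fin.last n) = p.2 :=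
  Fin.snoc_last (α := fun _ => ℝ) ..

lemma measurable_snocPath : Measurable (snocPath (n := n)) := by
  refine measurable_pi_lambda _ fun i => ?_
  refine Fin.lastCases ?_ (fun i => ?_) i
  · simpa using measurable_snd
  · simp only [snocPath_castSucc]
    fun_prop

/-- Splitting off the last coordinate of a path. -/
def splitPath (x : Fin (n + 1) → ℝ) : (Fin n → ℝ) × ℝ := (initSeg n n.le_succ x, x (Fin.last n))

lemma measurable_splitPath : Measurable (splitPath (n := n)) :=
  (measurable_initSeg _).prodMk (measurable_pi_apply _)

@[simp] lemma snocPath_splitPath (x : Fin (n + 1) → ℝ) : snocPath (splitPath x) = x := by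
  funext i
  refine Fin.lastCases ?_ (fun i => ?_) i
  · simp [splitPath]
  · rw [snocPath_castSucc]; rfl

@[simp] lemma splitPath_snocPath (p : (Fin n → ℝ) × ℝ) : splitPath (snocPath p) = p := by
  refine Prod.ext ?_ (by simp [splitPath])
  funext i
  exact snocPath_castSucc p i

lemma l1Dist_snocPath (p q : (Fin n → ℝ) × ℝ) :
    l1Dist (snocPath p) (snocPath q) = l1Dist p.1 q.1 + |p.2 - q.2| := by
  simp [l1Dist, Fin.sum_univ_castSucc]

/-- The plan obtained from `γ` by drawing the next pair of coordinates from the kernel `K`. -/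
noncomputable def extendPlan (γ : Measure ((Fin n → ℝ) × (Fin n → ℝ)))
    (K : Kernel ((Fin n → ℝ) × (Fin n → ℝ)) (ℝ × ℝ)) :
    Measure ((Fin (n + 1) → ℝ) × (Fin (n + 1) → ℝ)) :=
  (γ ⊗ₘ K).map fun w => (snocPath (w.1.1, w.2.1), snocPath (w.1.2, w.2.2))

lemma measurable_snocPath_pair :
    Measurable fun w : ((Fin n → ℝ) × (Fin n → ℝ)) × (ℝ × ℝ) =>
      (snocPath (w.1.1, w.2.1), snocPath (w.1.2, w.2.2)) :=
  (measurable_snocPath.comp (by fun_prop)).prodMk (measurable_snocPath.comp (by fun_prop))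

variable {γ : Measure ((Fin n → ℝ) × (Fin n → ℝ))} [IsProbabilityMeasure γ]
  {K : Kernel ((Fin n → ℝ) × (Fin n → ℝ)) (ℝ × ℝ)} [IsMarkovKernel K]

instance : IsProbabilityMeasure (extendPlan γ K) :=
  Measure.isProbabilityMeasure_map measurable_snocPath_pair.aemeasurable

lemma lintegral_extendPlan {F : (Fin (n + 1) → ℝ) × (Fin (n + 1) → ℝ) → ENNReal}
    (hF : Measurable F) :
    ∫⁻ z, F z ∂(extendPlan γ K) =
      ∫⁻ z, ∫⁻ w, F (snocPath (z.1, w.1), snocPath (z.2, w.2)) ∂(K z) ∂γ := by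
  rw [extendPlan, lintegral_map hF measurable_snocPath_pair,
    Measure.lintegral_compProd (hF.fun_comp measurable_snocPath_pair)]

/-- Reversing an extended plan is again an extension, so the noise representation can be propagated
in both directions by the same theorem. -/
lemma map_swap_extendPlan :
    (extendPlan γ K).map Prod.swap =
      extendPlan (γ.map Prod.swap) ((K.comap Prod.swap measurable_swap).map Prod.swap) := by
  have : IsProbabilityMeasure (γ.map Prod.swap) :=
    Measure.isProbabilityMeasure_map measurable_swap.aemeasurable
  have := Kernel.IsMarkovKernel.map (K.comap Prod.swap measurable_swap) measurable_swap
  refine Measure.ext_of_lintegral _ fun F hF => ?_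
  have hF' : Measurable fun z : ((Fin n → ℝ) × (Fin n → ℝ)) × (ℝ × ℝ) =>
      F (snocPath (z.1.1, z.2.1), snocPath (z.1.2, z.2.2)) := hF.comp measurable_snocPath_pair
  rw [lintegral_map hF measurable_swap,
    lintegral_extendPlan (F := fun z => F z.swap) (hF.comp measurable_swap),
    lintegral_extendPlan hF, lintegral_map hF'.lintegral_kernel_prod_right' measurable_swap]
  refine lintegral_congr fun z => ?_
  rw [Kernel.map_apply _ measurable_swap, Kernel.comap_apply, Prod.swap_swap,
    lintegral_map (hF'.fun_comp measurable_prodMk_left) measurable_swap]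
  rfl

/-- Given the two pasts and the new x-coordinate, the new y-coordinate is generated from a fresh
uniform variable. The assumption on the first marginal of K says that the new x-coordinate depends
on the past of x alone, so the old noise stays independent of the longer path. -/
theorem IsNoiseTransport.extendPlan {μ : Measure (Fin n → ℝ)} [IsProbabilityMeasure μ]
    (h : IsNoiseTransport μ γ) {κ : Kernel (Fin n → ℝ) ℝ} [IsMarkovKernel κ]
    (hK : ∀ z, (K z).map Prod.fst = κ z.1) :
    IsNoiseTransport ((μ ⊗ₘ κ).map snocPath) (extendPlan γ K) := by
  obtain ⟨Ω, _, P, _, Φ, hΦ, had, hγ⟩ := h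
  obtain ⟨f, hf, hfK⟩ := K.condKernel.exists_measurable_map_eq_unitInterval
  let Ψ : ((Fin n → ℝ) × ℝ) × (Ω × unitInterval) → (Fin n → ℝ) × ℝ := fun z =>
    (Φ (z.1.1, z.2.1), f ((z.1.1, Φ (z.1.1, z.2.1)), z.1.2) z.2.2)
  have hΨ : Measurable Ψ := by
    have h1 : Measurable fun z : ((Fin n → ℝ) × ℝ) × (Ω × unitInterval) => Φ (z.1.1, z.2.1) :=
      hΦ.comp (by fun_prop)
    refine h1.prodMk (hf.comp (Measurable.prodMk ?_ (by fun_prop)))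
    fun_prop
  refine ⟨Ω × unitInterval, inferInstance, P.prod volume, inferInstance,
    fun z => snocPath (Ψ (splitPath z.1, z.2)), ?_, ?_, ?_⟩
  · exact measurable_snocPath.comp (hΨ.comp
      ((measurable_splitPath.comp measurable_fst).prodMk measurable_snd))
  · intro t x x' ω hxx
    induction t using Fin.lastCases with
    | last =>
      have : x = x' := funext fun i => hxx i (Fin.le_last i)
      rw [this]
    | cast s =>
      simp only [snocPath_castSucc, Ψ]
      exact had s _ _ _ fun i hi => hxx i.castSucc (Fin.castSucc_le_castSucc_iff.2 hi)
  · refine Measure.ext_of_lintegral _ fun F hF => ?_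
    have hG : Measurable fun z : ((Fin n → ℝ) × ℝ) × (Ω × unitInterval) =>
        F (snocPath z.1, snocPath (Ψ z)) := hF.comp
      ((measurable_snocPath.comp measurable_fst).prodMk (measurable_snocPath.comp hΨ))
    have hmap : Measurable fun z : (Fin (n + 1) → ℝ) × (Ω × unitInterval) =>
        (z.1, snocPath (Ψ (splitPath z.1, z.2))) :=
      measurable_fst.prodMk (measurable_snocPath.comp (hΨ.comp
        ((measurable_splitPath.comp measurable_fst).prodMk measurable_snd)))
    have hR : ∫⁻ z, F z ∂(((μ ⊗ₘ κ).map snocPath).prod (P.prod volume)).map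
        (fun z => (z.1, snocPath (Ψ (splitPath z.1, z.2)))) =
        ∫⁻ p, ∫⁻ x, ∫⁻ ω, ∫⁻ v, F (snocPath (p, x), snocPath (Ψ ((p, x), (ω, v)))) ∂volume ∂P
          ∂(κ p) ∂μ := by
      rw [lintegral_map hF hmap, lintegral_prod _ (hF.fun_comp hmap).aemeasurable,
        lintegral_map (hF.fun_comp hmap).lintegral_prod_right' measurable_snocPath]
      simp only [splitPath_snocPath]
      rw [Measure.lintegral_compProd hG.lintegral_prod_right']
      refine lintegral_congr fun p => lintegral_congr fun x => ?_
      rw [lintegral_prod _ (hG.fun_comp measurable_prodMk_left).aemeasurable]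
    have hL : ∫⁻ z, F z ∂(_root_.extendPlan γ K) =
        ∫⁻ p, ∫⁻ ω, ∫⁻ x, ∫⁻ v, F (snocPath (p, x), snocPath (Ψ ((p, x), (ω, v)))) ∂volume
          ∂(κ p) ∂P ∂μ := by
      have hF' : Measurable fun z : ((Fin n → ℝ) × (Fin n → ℝ)) × (ℝ × ℝ) =>
        F (snocPath (z.1.1, z.2.1), snocPath (z.1.2, z.2.2)) := hF.comp measurable_snocPath_pair
      rw [lintegral_extendPlan hF, hγ,
        lintegral_map hF'.lintegral_kernel_prod_right' (measurable_fst.prodMk hΦ),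
        lintegral_prod _ (hF'.lintegral_kernel_prod_right'.fun_comp
          (measurable_fst.prodMk hΦ)).aemeasurable]
      refine lintegral_congr fun p => lintegral_congr fun ω => ?_
      have hz := hF'.comp (measurable_prodMk_left (x := (p, Φ (p, ω))))
      have hKd : ∀ G : ℝ × ℝ → ENNReal, Measurable G → ∀ z, ∫⁻ w, G w ∂(K z) =
          ∫⁻ x, ∫⁻ v, G (x, f (z, x) v) ∂volume ∂(κ z.1) := by
        intro G hG z
        have e1 : K.fst z = κ z.1 := by rw [Kernel.fst_apply, hK]
        rw [← e1]
        conv_lhs => rw [← K.disintegrate K.condKernel]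
        rw [Kernel.lintegral_compProd _ _ _ hG]
        refine lintegral_congr fun x => ?_
        rw [← hfK, lintegral_map (hG.fun_comp measurable_prodMk_left) hf.of_uncurry_left]
      exact hKd _ hz _
    -- The two iterated integrals differ only in the order of P and κ p, and κ p does not involve ω,
    -- so Tonelli applies.
    rw [hL, hR]
    refine lintegral_congr fun p => lintegral_lintegral_swap ?_
    refine Measurable.aemeasurable ?_
    have : Measurable fun z : (Ω × ℝ) × unitInterval =>
        F (snocPath (p, z.1.2), snocPath (Ψ ((p, z.1.2), (z.1.1, z.2)))) :=
      hG.fun_comp (f := fun z : (Ω × ℝ) × unitInterval => ((p, z.1.2), (z.1.1, z.2))) (by fun_prop)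
    exact this.lintegral_prod_right'

end Extension

/-! ### The quantile coupling of two kernels -/

section QuantileKernel

open InformationTheory

variable {α : Type*} [MeasurableSpace α]

/-- The quantile coupling of `κ p` and `η q`, as a kernel in `(p, q)`. -/
noncomputable def quantileKernel (κ η : Kernel α ℝ) : Kernel (α × α) (ℝ × ℝ) :=
  (Kernel.id ×ₖ Kernel.const _ unitLaw).map
    fun w : (α × α) × ℝ => (quantile (κ w.1.1) w.2, quantile (η w.1.2) w.2)

variable {κ η : Kernel α ℝ} [IsMarkovKernel κ] [IsMarkovKernel η]

lemma measurable_quantile_pair : Measurable fun w : (α × α) × ℝ =>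
    (quantile (κ w.1.1) w.2, quantile (η w.1.2) w.2) :=
  ((measurable_quantile κ).fun_comp (f := fun w : (α × α) × ℝ => (w.1.1, w.2))
    (by fun_prop)).prodMk
  ((measurable_quantile η).fun_comp (f := fun w : (α × α) × ℝ => (w.1.2, w.2)) (by fun_prop))

instance : IsMarkovKernel (quantileKernel κ η) :=
  Kernel.IsMarkovKernel.map _ measurable_quantile_pair

lemma quantileKernel_apply (z : α × α) : quantileKernel κ η z =
    unitLaw.map fun s => (quantile (κ z.1) s, quantile (η z.2) s) := by
  rw [quantileKernel, Kernel.map_apply _ measurable_quantile_pair, Kernel.prod_apply,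
    Kernel.id_apply, Kernel.const_apply, Measure.dirac_prod,
    Measure.map_map measurable_quantile_pair measurable_prodMk_left]
  rfl

lemma map_fst_quantileKernel (z : α × α) : (quantileKernel κ η z).map Prod.fst = κ z.1 := by
  rw [quantileKernel_apply, Measure.map_map measurable_fst
    ((measurable_quantile_right _).prodMk (measurable_quantile_right _))]
  exact map_quantile _

lemma map_snd_quantileKernel (z : α × α) : (quantileKernel κ η z).map Prod.snd = η z.2 := by
  rw [quantileKernel_apply, Measure.map_map measurable_snd
    ((measurable_quantile_right _).prodMk (measurable_quantile_right _))]
  exact map_quantile _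

/-- Disintegration of the relative entropy of two compositions with the same first marginal. -/
lemma klDiv_compProd_eq_lintegral [MeasurableSpace.CountableOrCountablyGenerated α ℝ]
    {ν : Measure α} [IsFiniteMeasure ν] (hac : ν ⊗ₘ η ≪ ν ⊗ₘ κ) :
    (∀ᵐ q ∂ν, η q = (κ q).withDensity (η.rnDeriv κ q)) ∧
    klDiv (ν ⊗ₘ η) (ν ⊗ₘ κ) =
      ∫⁻ q, ∫⁻ z, ENNReal.ofReal (klFun (η.rnDeriv κ q z).toReal) ∂(κ q) ∂ν := by
  have hv : Measurable (Function.uncurry (η.rnDeriv κ)) := Kernel.measurable_rnDeriv η κ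
  have h1 : ∀ᵐ q ∂ν, η q = κ.withDensity (η.rnDeriv κ) q := by
    filter_upwards [hac.kernel_of_compProd] with q hq
    exact (Kernel.withDensity_rnDeriv_eq hq).symm
  refine ⟨h1.mono fun q hq => by rw [hq, Kernel.withDensity_apply _ hv], ?_⟩
  have h2 : ν ⊗ₘ η = (ν ⊗ₘ κ).withDensity (fun p => η.rnDeriv κ p.1 p.2) := by
    rw [Measure.compProd_congr h1, Measure.compProd_withDensity hv]
  have h3 : (ν ⊗ₘ η).rnDeriv (ν ⊗ₘ κ) =ᵐ[ν ⊗ₘ κ] fun p => η.rnDeriv κ p.1 p.2 := by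
    rw [h2]
    exact Measure.rnDeriv_withDensity _ hv
  have hm : Measurable fun p : α × ℝ => ENNReal.ofReal (klFun (η.rnDeriv κ p.1 p.2).toReal) :=
    (measurable_klFun.comp hv.ennreal_toReal).ennreal_ofReal
  rw [klDiv_eq_lintegral_klFun_of_ac hac, ← Measure.lintegral_compProd hm]
  exact lintegral_congr_ae (h3.mono fun p hp => by simp only [hp])

/-- Jensen for the square root, as Cauchy–Schwarz against the constant 1. -/
lemma lintegral_rpow_half_le {ν : Measure α} [IsProbabilityMeasure ν] {f : α → ENNReal}
    (hf : AEMeasurable f ν) :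
    ∫⁻ q, f q ^ (1 / 2 : ℝ) ∂ν ≤ (∫⁻ q, f q ∂ν) ^ (1 / 2 : ℝ) := by
  have h := lintegral_mul_sq_le (m := ν) (hf.pow_const (1 / 2 : ℝ)) (aemeasurable_const (b := 1))
  have e : ∀ x : ENNReal, (x ^ (1 / 2 : ℝ)) ^ 2 = x := fun x => by
    rw [← ENNReal.rpow_two, ← ENNReal.rpow_mul]; norm_num
  simp only [mul_one, e, one_pow, lintegral_const, measure_univ] at h
  have h' := ENNReal.rpow_le_rpow h (by norm_num : (0 : ℝ) ≤ 1 / 2)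
  rwa [← ENNReal.rpow_two, ← ENNReal.rpow_mul, show (2 : ℝ) * (1 / 2) = 1 by norm_num,
    ENNReal.rpow_one] at h'

/-- The expected cost of the quantile coupling of the next coordinates. -/
theorem lintegral_quantile_le [MeasurableSpace.CountableOrCountablyGenerated α ℝ]
    {μ ν : Measure α} [IsProbabilityMeasure ν] {γ : Measure (α × α)}
    (hfst : γ.map Prod.fst = μ) (hsnd : γ.map Prod.snd = ν) (hνμ : ν ≪ μ) {d : α → α → ℝ}
    (hd : Measurable fun p : α × α => d p.1 p.2)
    {a L : ℝ} (ha : 0 < a)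
    (hexp : ∀ᵐ p ∂μ, ∫⁻ z, ENNReal.ofReal (Real.exp (a * z ^ 2)) ∂(κ p) ≤
      ENNReal.ofReal (Real.exp L))
    (hlip : ∀ f : ℝ → ℝ, LipschitzWith 1 f → ∃ g : α → ℝ, (∀ p q, |g p - g q| ≤ d p q) ∧
      ∀ᵐ x ∂μ, ∫ z, f z ∂(κ x) = g x)
    (hkl : klDiv (ν ⊗ₘ η) (ν ⊗ₘ κ) ≠ ⊤) :
    ∫⁻ z, ∫⁻ s, ENNReal.ofReal |quantile (κ z.1) s - quantile (η z.2) s| ∂unitLaw ∂γ ≤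
      ∫⁻ z, ENNReal.ofReal (d z.1 z.2) ∂γ +
        (ENNReal.ofReal (2 * ((1 + L) / a)) * klDiv (ν ⊗ₘ η) (ν ⊗ₘ κ)) ^ (1 / 2 : ℝ) := by
  have hac : ν ⊗ₘ η ≪ ν ⊗ₘ κ := (klDiv_ne_top_iff.1 hkl).1
  obtain ⟨hdens, hklq⟩ := klDiv_compProd_eq_lintegral hac
  have hv : Measurable (Function.uncurry (η.rnDeriv κ)) := Kernel.measurable_rnDeriv η κ
  have hm : Measurable fun p : α × ℝ => ENNReal.ofReal (klFun (η.rnDeriv κ p.1 p.2).toReal) :=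
    (measurable_klFun.comp hv.ennreal_toReal).ennreal_ofReal
  let k : α → ENNReal := fun q => ∫⁻ z, ENNReal.ofReal (klFun (η.rnDeriv κ q z).toReal) ∂(κ q)
  have hk : Measurable k := hm.lintegral_kernel_prod_right'
  have hkfin : ∀ᵐ q ∂ν, k q ≠ ⊤ := by
    rw [hklq] at hkl
    exact (ae_lt_top hk hkl).mono fun q hq => hq.ne
  obtain ⟨G, hGae, hG⟩ := exists_ae_forall_lipschitz_le (κ := κ)
    (hexp.mono fun p hp => integrable_id_of_lintegral_exp_sq_le ha hp) hlip
  have hfst' : ∀ {P : α → Prop}, (∀ᵐ p ∂μ, P p) → ∀ᵐ z ∂γ, P z.1 := fun h => by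
    rw [← hfst] at h
    exact ae_of_ae_map measurable_fst.aemeasurable h
  have hsnd' : ∀ {P : α → Prop}, (∀ᵐ p ∂ν, P p) → ∀ᵐ z ∂γ, P z.2 := fun h => by
    rw [← hsnd] at h
    exact ae_of_ae_map measurable_snd.aemeasurable h
  have hbound : ∀ᵐ z ∂γ,
      ∫⁻ s, ENNReal.ofReal |quantile (κ z.1) s - quantile (η z.2) s| ∂unitLaw ≤
        ENNReal.ofReal (d z.1 z.2) +
          (ENNReal.ofReal (2 * ((1 + L) / a)) * k z.2) ^ (1 / 2 : ℝ) := by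
    -- Since ν ≪ μ, the properties of κ that hold μ-a.s. are also available at the second coordinate
    -- z.2, of law ν.
    filter_upwards [hfst' hexp, hfst' hGae, hsnd' (hνμ.ae_le hexp), hsnd' (hνμ.ae_le hGae),
      hsnd' hkfin, hsnd' hdens] with z he1 hG1 he2 hG2 hk2 hd2
    have hvz : Measurable (η.rnDeriv κ z.2) := Kernel.measurable_rnDeriv_right η κ z.2
    refine lintegral_quantile_sub_le (integrable_id_of_lintegral_exp_sq_le ha he1)
      (integrable_id_withDensity hvz hd2 ha he2 hk2) fun f hf => ?_
    -- The intermediate law κ z.2 separates the change of past, handled by the Lipschitz bound, from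
    -- the change of measure, handled by Pinsker.
    have e : ∫ x, f x ∂(κ z.1) - ∫ x, f x ∂(η z.2) =
        (∫ x, f x ∂(κ z.1) - ∫ x, f x ∂(κ z.2)) +
          (∫ x, f x ∂(κ z.2) - ∫ x, f x ∂(η z.2)) := by ring
    rw [e]
    refine ENNReal.ofReal_add_le.trans (add_le_add ?_ ?_)
    · exact ENNReal.ofReal_le_ofReal (hG _ hG1 _ hG2 f hf)
    · exact ofReal_integral_sub_le hvz hd2 ha he2 hk2 hf
  refine (lintegral_mono_ae hbound).trans ?_
  rw [lintegral_add_left hd.ennreal_ofReal]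
  gcongr
  have hk' : Measurable fun q => ENNReal.ofReal (2 * ((1 + L) / a)) * k q := hk.const_mul _
  calc _ = ∫⁻ q, (ENNReal.ofReal (2 * ((1 + L) / a)) * k q) ^ (1 / 2 : ℝ) ∂ν := by
        rw [← hsnd, lintegral_map (hk'.pow_const _) measurable_snd]
    _ ≤ _ := lintegral_rpow_half_le hk'.aemeasurable
    _ = _ := by rw [lintegral_const_mul _ hk, hklq]

end QuantileKernel

/-! ### Construction of a bicausal plan -/

section Construction

open InformationTheory

variable {n : ℕ}

instance {N : ℕ} (μ : Measure (Fin N → ℝ)) [IsFiniteMeasure μ] (t : Fin N) :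
    IsMarkovKernel (condLaw μ t) := by
  unfold condLaw; infer_instance

/-- The law of the first `n` coordinates. -/
noncomputable abbrev initLaw (μ : Measure (Fin (n + 1) → ℝ)) : Measure (Fin n → ℝ) :=
  μ.map (initSeg n n.le_succ)

instance (μ : Measure (Fin (n + 1) → ℝ)) [IsProbabilityMeasure μ] :
    IsProbabilityMeasure (initLaw μ) :=
  Measure.isProbabilityMeasure_map (measurable_initSeg _).aemeasurable

/-- The conditional law of the last coordinate. -/
noncomputable def lastLaw (μ : Measure (Fin (n + 1) → ℝ)) [IsFiniteMeasure μ] :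
    Kernel (Fin n → ℝ) ℝ := condLaw μ (Fin.last n)

instance (μ : Measure (Fin (n + 1) → ℝ)) [IsFiniteMeasure μ] : IsMarkovKernel (lastLaw μ) :=
  inferInstanceAs (IsMarkovKernel (condLaw μ (Fin.last n)))

lemma initLaw_compProd_lastLaw (μ : Measure (Fin (n + 1) → ℝ)) [IsProbabilityMeasure μ] :
    initLaw μ ⊗ₘ lastLaw μ = μ.map splitPath :=
  compProd_map_condDistrib (μ := μ) (X := initSeg n n.le_succ) (Y := fun x => x (Fin.last n))
    (measurable_pi_apply _).aemeasurable

lemma map_snocPath_compProd (μ : Measure (Fin (n + 1) → ℝ)) [IsProbabilityMeasure μ] :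
    (initLaw μ ⊗ₘ lastLaw μ).map snocPath = μ := by
  rw [initLaw_compProd_lastLaw, Measure.map_map measurable_snocPath measurable_splitPath]
  convert Measure.map_id
  exact funext snocPath_splitPath

/-- The conditional law is determined by the joint law of the past and the coordinate, which
truncation preserves. Hence (EXP) and (LIP) are inherited in the induction. -/
lemma condLaw_initLaw (μ : Measure (Fin (n + 1) → ℝ)) [IsProbabilityMeasure μ] (t : Fin n) :
    condLaw (initLaw μ) t = condLaw μ t.castSucc := by
  unfold condLaw
  rw [condDistrib, condDistrib]
  have : (initLaw μ).map (fun x => (initSeg t t.isLt.le x, x t)) =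
      μ.map fun x => (initSeg t t.castSucc.isLt.le x, x t.castSucc) :=
    Measure.map_map ((measurable_initSeg _).prodMk (measurable_pi_apply _)) (measurable_initSeg _)
  congr 1

lemma ae_initLaw {μ : Measure (Fin (n + 1) → ℝ)} {P : (Fin n → ℝ) → Prop}
    (hP : MeasurableSet {p | P p}) (h : ∀ᵐ x ∂μ, P (initSeg n n.le_succ x)) :
    ∀ᵐ p ∂(initLaw μ), P p :=
  (ae_map_iff (measurable_initSeg _).aemeasurable hP).2 h

lemma continuous_of_abs_sub_le_l1Dist {k : ℕ} {C : ℝ} {g : (Fin k → ℝ) → ℝ}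
    (hg : ∀ p q, |g p - g q| ≤ C * l1Dist p q) : Continuous g := by
  refine continuous_iff_continuousAt.2 fun q => ?_
  rw [ContinuousAt, tendsto_iff_dist_tendsto_zero]
  have h0 : Filter.Tendsto (fun p => C * l1Dist p q) (nhds q) (nhds 0) := by
    have : Continuous fun p : Fin k → ℝ => C * l1Dist p q := by
      unfold l1Dist; fun_prop
    simpa [l1Dist] using this.tendsto q
  exact squeeze_zero (fun _ => dist_nonneg) (fun p => by rw [Real.dist_eq]; exact hg p q) h0

variable {μ ν : Measure (Fin (n + 1) → ℝ)} [IsProbabilityMeasure μ] [IsProbabilityMeasure ν]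

lemma CondEXP.map_initSeg {a lam : Fin (n + 1) → ℝ} (h : CondEXP μ a lam) :
    CondEXP (initLaw μ) (fun t => a t.castSucc) (fun t => lam t.castSucc) := by
  intro t
  rw [condLaw_initLaw]
  refine ae_initLaw ?_ (h t.castSucc)
  refine measurableSet_le ?_ measurable_const
  exact (Measurable.lintegral_kernel (by fun_prop)).comp (measurable_initSeg _)

lemma CondEXP.ae_lastLaw {a lam : Fin (n + 1) → ℝ} (h : CondEXP μ a lam) :
    ∀ᵐ p ∂(initLaw μ),
      ∫⁻ z, ENNReal.ofReal (Real.exp (a (Fin.last n) * z ^ 2)) ∂(lastLaw μ p) ≤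
        ENNReal.ofReal (Real.exp (lam (Fin.last n))) := by
  refine ae_initLaw ?_ (h (Fin.last n))
  exact measurableSet_le (Measurable.lintegral_kernel (by fun_prop)) measurable_const

lemma measurableSet_integral_eq {k : ℕ} {C : ℝ} (κ : Kernel (Fin k → ℝ) ℝ) [IsMarkovKernel κ]
    {f : ℝ → ℝ} (hf : LipschitzWith 1 f) {g : (Fin k → ℝ) → ℝ}
    (hg : ∀ p q, |g p - g q| ≤ C * l1Dist p q) :
    MeasurableSet {p | ∫ z, f z ∂(κ p) = g p} :=
  measurableSet_eq_fun
    (hf.continuous.measurable.stronglyMeasurable.integral_kernel (κ := κ)).measurable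
    (continuous_of_abs_sub_le_l1Dist hg).measurable

lemma CondLIP.map_initSeg {C : ℝ} (h : CondLIP μ C) : CondLIP (initLaw μ) C := by
  intro t f hf
  obtain ⟨g, hg, hae⟩ := h t.castSucc f hf
  refine ⟨g, hg, ?_⟩
  rw [condLaw_initLaw]
  refine ae_initLaw ?_ hae
  exact measurable_initSeg _ (measurableSet_integral_eq (condLaw μ t.castSucc) hf hg)

lemma CondLIP.ae_lastLaw {C : ℝ} (h : CondLIP μ C) (f : ℝ → ℝ) (hf : LipschitzWith 1 f) :
    ∃ g : (Fin n → ℝ) → ℝ, (∀ p q, |g p - g q| ≤ C * l1Dist p q) ∧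
      ∀ᵐ p ∂(initLaw μ), ∫ z, f z ∂(lastLaw μ p) = g p := by
  obtain ⟨g, hg, hae⟩ := h (Fin.last n) f hf
  exact ⟨g, hg, ae_initLaw (measurableSet_integral_eq (lastLaw μ) hf hg) hae⟩

/-- Extending a plan between the initial laws by the quantile coupling of the conditional laws. -/
lemma lintegral_l1Dist_extendPlan_le {a lam : Fin (n + 1) → ℝ} (ha : ∀ t, 0 < a t) {C : ℝ}
    (hC : 0 ≤ C) (hEXP : CondEXP μ a lam) (hLIP : CondLIP μ C) (hνμ : initLaw ν ≪ initLaw μ)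
    (hkl : klDiv (initLaw ν ⊗ₘ lastLaw ν) (initLaw ν ⊗ₘ lastLaw μ) ≠ ⊤)
    {γ : Measure ((Fin n → ℝ) × (Fin n → ℝ))} [IsProbabilityMeasure γ]
    (hfst : γ.map Prod.fst = initLaw μ) (hsnd : γ.map Prod.snd = initLaw ν) :
    ∫⁻ z, ENNReal.ofReal (l1Dist z.1 z.2)
        ∂(extendPlan γ (quantileKernel (lastLaw μ) (lastLaw ν))) ≤
      ENNReal.ofReal (1 + C) * ∫⁻ z, ENNReal.ofReal (l1Dist z.1 z.2) ∂γ +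
        (ENNReal.ofReal (2 * ((1 + lam (Fin.last n)) / a (Fin.last n))) *
          klDiv (initLaw ν ⊗ₘ lastLaw ν) (initLaw ν ⊗ₘ lastLaw μ)) ^ (1 / 2 : ℝ) := by
  have hl : Measurable fun z : (Fin n → ℝ) × (Fin n → ℝ) => ENNReal.ofReal (l1Dist z.1 z.2) :=
    measurable_l1Dist.ennreal_ofReal
  have h := lintegral_quantile_le hfst hsnd hνμ (d := fun p q => C * l1Dist p q)
    (measurable_l1Dist.const_mul C) (ha _) hEXP.ae_lastLaw hLIP.ae_lastLaw hkl
  rw [lintegral_extendPlan measurable_l1Dist.ennreal_ofReal]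
  -- The old distance is kept and the new coordinate adds at most C times it: hence the factor 1 +
  -- C.
  have e : ∀ z : (Fin n → ℝ) × (Fin n → ℝ),
      ∫⁻ w, ENNReal.ofReal (l1Dist (snocPath (z.1, w.1)) (snocPath (z.2, w.2)))
        ∂(quantileKernel (lastLaw μ) (lastLaw ν) z) =
      ENNReal.ofReal (l1Dist z.1 z.2) + ∫⁻ s, ENNReal.ofReal
        |quantile (lastLaw μ z.1) s - quantile (lastLaw ν z.2) s| ∂unitLaw := by
    intro z
    simp only [l1Dist_snocPath, ENNReal.ofReal_add (l1Dist_nonneg _ _) (abs_nonneg _)]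
    rw [lintegral_add_left measurable_const, lintegral_const, measure_univ, mul_one,
      quantileKernel_apply, lintegral_map (by fun_prop)
        ((measurable_quantile_right _).prodMk (measurable_quantile_right _))]
  simp only [e]
  rw [lintegral_add_left hl, ENNReal.ofReal_add zero_le_one hC, ENNReal.ofReal_one, add_mul,
    one_mul, add_assoc]
  gcongr
  refine h.trans (le_of_eq ?_)
  simp only [ENNReal.ofReal_mul hC]
  rw [lintegral_const_mul _ hl]

end Construction

open InformationTheory in
/-- A plan of small cost that is a noise transport in both directions. -/
theorem exists_noiseTransport {n : ℕ} (μ ν : Measure (Fin n → ℝ)) [IsProbabilityMeasure μ]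
    [IsProbabilityMeasure ν] (a lam : Fin n → ℝ) (ha : ∀ t, 0 < a t) {C : ℝ} (hC : 0 ≤ C)
    (hEXP : CondEXP μ a lam) (hLIP : CondLIP μ C) (hkl : klDiv ν μ ≠ ⊤) :
    ∃ γ : Measure ((Fin n → ℝ) × (Fin n → ℝ)), IsProbabilityMeasure γ ∧
      IsNoiseTransport μ γ ∧ IsNoiseTransport ν (γ.map Prod.swap) ∧
      ∃ h : Fin n → ENNReal, ∑ t, h t ≤ klDiv ν μ ∧
        ∫⁻ z, ENNReal.ofReal (l1Dist z.1 z.2) ∂γ ≤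
          ∑ t, ENNReal.ofReal (1 + C) ^ (t.rev : ℕ) *
            (ENNReal.ofReal (2 * ((1 + lam t) / a t)) * h t) ^ (1 / 2 : ℝ) := by
  induction n with
  | zero =>
    refine ⟨μ.prod ν, inferInstance, isNoiseTransport_prod μ ν, ?_, 0, by simp, by simp [l1Dist]⟩
    rw [Measure.prod_swap]
    exact isNoiseTransport_prod ν μ
  | succ n ih =>
    -- Data processing for the splitting map; the chain rule then separates the entropy of the past
    -- from the conditional entropy, averaged over the past under ν.
    have hsplit : klDiv (initLaw ν ⊗ₘ lastLaw ν) (initLaw μ ⊗ₘ lastLaw μ) ≤ klDiv ν μ := by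
      rw [initLaw_compProd_lastLaw, initLaw_compProd_lastLaw]
      exact klDiv_map_le _ _ measurable_splitPath
    rw [klDiv_compProd_eq_add] at hsplit
    have hfin := ENNReal.add_ne_top.1 (ne_top_of_le_ne_top hkl hsplit)
    obtain ⟨γ, _, hμγ, hνγ, h, hh, hcost⟩ := ih (initLaw μ) (initLaw ν) _ _
      (fun t => ha t.castSucc) hEXP.map_initSeg hLIP.map_initSeg hfin.1
    have hsnd : γ.map Prod.snd = initLaw ν := by
      rw [← hνγ.map_fst, Measure.map_map measurable_fst measurable_swap]
      rfl
    refine ⟨extendPlan γ (quantileKernel (lastLaw μ) (lastLaw ν)), inferInstance, ?_, ?_,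
      Fin.snoc (α := fun _ => ENNReal) h
        (klDiv (initLaw ν ⊗ₘ lastLaw ν) (initLaw ν ⊗ₘ lastLaw μ)), ?_, ?_⟩
    · have := hμγ.extendPlan (map_fst_quantileKernel (κ := lastLaw μ) (η := lastLaw ν))
      rwa [map_snocPath_compProd] at this
    · have : IsProbabilityMeasure (γ.map Prod.swap) :=
        Measure.isProbabilityMeasure_map measurable_swap.aemeasurable
      have := Kernel.IsMarkovKernel.map ((quantileKernel (lastLaw μ) (lastLaw ν)).comap Prod.swap
        measurable_swap) measurable_swap
      have h := hνγ.extendPlan (κ := lastLaw ν) (K := ((quantileKernel (lastLaw μ)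
        (lastLaw ν)).comap Prod.swap measurable_swap).map Prod.swap) fun z => by
          rw [Kernel.map_apply _ measurable_swap, Kernel.comap_apply,
            Measure.map_map measurable_fst measurable_swap]
          exact map_snd_quantileKernel z.swap
      rwa [map_snocPath_compProd, ← map_swap_extendPlan] at h
    · rw [Fin.sum_univ_castSucc]
      simp only [Fin.snoc_castSucc, Fin.snoc_last]
      exact (add_le_add_left hh _).trans hsplit
    · refine (lintegral_l1Dist_extendPlan_le ha hC hEXP hLIP (klDiv_ne_top_iff.1 hfin.1).1 hfin.2
        hμγ.map_fst hsnd).trans ?_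
      rw [Fin.sum_univ_castSucc]
      simp only [Fin.snoc_castSucc, Fin.snoc_last, Fin.rev_castSucc, Fin.val_succ, Fin.rev_last,
        Fin.val_zero, pow_zero, one_mul, pow_succ']
      gcongr
      -- Each earlier time gains one factor 1 + C, matching the increment of its reversed index.
      refine (mul_le_mul_right hcost _).trans (le_of_eq ?_)
      rw [Finset.mul_sum]
      exact Finset.sum_congr rfl fun t _ => (mul_assoc _ _ _).symm

/-! ### Values of multistage programs -/

section ProgValue

lemma extIntegral_eq_add {α : Type*} [MeasurableSpace α] {η : Measure α} [IsProbabilityMeasure η]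
    {f : α → ℝ} (hf : Measurable f) {b : ℝ} (hb : ∀ x, b ≤ f x) :
    extIntegral η f = ((∫⁻ x, ENNReal.ofReal (f x - b) ∂η : ENNReal) : EReal) + (b : EReal) := by
  -- This is f⁺ + b⁻ = (f - b) + f⁻ + b⁺, integrated: an additive form that avoids subtracting
  -- infinities.
  have hid : ∫⁻ x, ENNReal.ofReal (f x) ∂η + ENNReal.ofReal (-b) =
      ∫⁻ x, ENNReal.ofReal (f x - b) ∂η + ∫⁻ x, ENNReal.ofReal (-f x) ∂η + ENNReal.ofReal b := by
    have h : ∀ x, ENNReal.ofReal (f x) + ENNReal.ofReal (-b) =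
        ENNReal.ofReal (f x - b) + ENNReal.ofReal (-f x) + ENNReal.ofReal b := by
      intro x
      have hx := hb x
      rcases le_total 0 b with h0 | h0
      · rw [ENNReal.ofReal_of_nonpos (by linarith : -b ≤ 0),
          ENNReal.ofReal_of_nonpos (by linarith : -f x ≤ 0), add_zero, add_zero,
          ← ENNReal.ofReal_add (by linarith) h0, sub_add_cancel]
      · rw [ENNReal.ofReal_of_nonpos h0, add_zero]
        rcases le_total 0 (f x) with h1 | h1
        · rw [ENNReal.ofReal_of_nonpos (by linarith : -f x ≤ 0), add_zero,
            ← ENNReal.ofReal_add h1 (by linarith), sub_eq_add_neg]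
        · rw [ENNReal.ofReal_of_nonpos h1, zero_add,
            ← ENNReal.ofReal_add (by linarith) (by linarith)]
          congr 1; ring
    have h' := lintegral_congr (μ := η) h
    rw [lintegral_add_right _ measurable_const, lintegral_add_right _ measurable_const,
      lintegral_add_right _ (by fun_prop)] at h'
    simpa using h'
  have hB : ∫⁻ x, ENNReal.ofReal (-f x) ∂η ≠ ⊤ := by
    refine ne_top_of_le_ne_top (b := ∫⁻ _, ENNReal.ofReal (-b) ∂η) (by simp)
      (lintegral_mono fun x => ENNReal.ofReal_le_ofReal (neg_le_neg (hb x)))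
  unfold extIntegral
  generalize ∫⁻ x, ENNReal.ofReal (f x) ∂η = A at *
  generalize ∫⁻ x, ENNReal.ofReal (f x - b) ∂η = D at *
  generalize ∫⁻ x, ENNReal.ofReal (-f x) ∂η = B at *
  lift B to NNReal using hB
  by_cases hD : D = ⊤
  · have hA : A = ⊤ := by
      by_contra hA
      rw [hD, top_add, top_add] at hid
      exact ENNReal.add_ne_top.2 ⟨hA, ENNReal.ofReal_ne_top⟩ hid
    rw [hA, hD]
    simp only [EReal.coe_ennreal_top]
    rw [EReal.top_add_of_ne_bot (EReal.coe_ne_bot b), sub_eq_add_neg,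
      EReal.top_add_of_ne_bot]
    exact_mod_cast EReal.coe_ne_bot (-(B : ℝ))
  · have hA : A ≠ ⊤ := by
      intro hA
      rw [hA, top_add] at hid
      exact ENNReal.add_ne_top.2 ⟨ENNReal.add_ne_top.2 ⟨hD, ENNReal.coe_ne_top⟩,
        ENNReal.ofReal_ne_top⟩ hid.symm
    lift A to NNReal using hA
    lift D to NNReal using hD
    have h := congrArg ENNReal.toReal hid
    rw [ENNReal.toReal_add (by simp) (by simp), ENNReal.toReal_add (by simp) (by simp),
      ENNReal.toReal_add (by simp) (by simp)] at h
    simp only [ENNReal.coe_toReal, ENNReal.toReal_ofReal'] at h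
    have hb' : max b 0 - max (-b) 0 = b := max_zero_sub_max_neg_zero_eq_self b
    have : (A : ℝ) - B = D + b := by linarith
    simp only [EReal.coe_nnreal_eq_coe_real]
    rw [← EReal.coe_sub, this, EReal.coe_add]

variable {N : ℕ}

/-- The value of a program relative to a lower bound `b` of the objective. -/
noncomputable def shiftedValue (H : (Fin N → ℝ) → (Fin N → ℝ) → ℝ) (b : ℝ)
    (η : Measure (Fin N → ℝ)) : ENNReal :=
  ⨅ w ∈ adaptedControls N, ∫⁻ x, ENNReal.ofReal (H x (controlPath w x) - b) ∂η

/-- Adding b is monotone, continuous and fixes ⊤, so it commutes with the infimum over controls. -/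
lemma progValue_eq_shiftedValue_add {H : (Fin N → ℝ) → (Fin N → ℝ) → ℝ}
    (hH : Measurable fun p : _ × _ => H p.1 p.2) {b : ℝ} (hb : ∀ x u, b ≤ H x u)
    (η : Measure (Fin N → ℝ)) [IsProbabilityMeasure η] :
    progValue H η = (shiftedValue H b η : EReal) + (b : EReal) := by
  let φ : ENNReal → EReal := fun D => (D : EReal) + (b : EReal)
  have hφm : Monotone φ := fun x y hxy =>
    add_le_add_left (EReal.coe_ennreal_le_coe_ennreal_iff.2 hxy) _
  have hφc : Continuous φ := by
    refine continuous_iff_continuousAt.2 fun D => ?_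
    have h1 : ContinuousAt (fun p : EReal × EReal => p.1 + p.2) ((D : EReal), (b : EReal)) :=
      EReal.continuousAt_add (Or.inr (EReal.coe_ne_bot b)) (Or.inr (EReal.coe_ne_top b))
    have h2 : ContinuousAt (fun D : ENNReal => ((D : EReal), (b : EReal))) D :=
      (continuous_coe_ennreal_ereal.prodMk continuous_const).continuousAt
    exact h1.comp (f := fun D : ENNReal => ((D : EReal), (b : EReal))) h2
  have hφt : φ ⊤ = ⊤ := by
    simp only [φ, EReal.coe_ennreal_top]
    exact EReal.top_add_of_ne_bot (EReal.coe_ne_bot b)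
  change _ = φ _
  rw [shiftedValue, iInf_subtype', hφm.map_iInf_of_continuousAt hφc.continuousAt hφt, progValue,
    iInf_subtype']
  refine iInf_congr fun w => ?_
  exact extIntegral_eq_add (f := fun x => H x (controlPath w x))
    (hH.comp (measurable_id.prodMk (measurable_controlPath w.2))) fun x => hb _ _

/-- Finiteness of x matters: in `EReal`, ⊤ - ⊤ = ⊥ has absolute value ⊤. Finiteness of y follows
when R is finite. -/
lemma EReal.abs_add_sub_add_le {x y R : ENNReal} (b : ℝ) (hx : x ≠ ⊤) (hxy : x ≤ y + R)
    (hyx : y ≤ x + R) :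
    (((x : EReal) + (b : EReal)) - ((y : EReal) + (b : EReal))).abs ≤ R := by
  by_cases hR : R = ⊤
  · exact hR ▸ le_top
  have hy : y ≠ ⊤ := ne_top_of_le_ne_top (ENNReal.add_ne_top.2 ⟨hx, hR⟩) hyx
  lift x to NNReal using hx
  lift y to NNReal using hy
  lift R to NNReal using hR
  have e : (((x : ENNReal) : EReal) + (b : EReal)) - (((y : ENNReal) : EReal) + (b : EReal)) =
      (((x : ℝ) - y : ℝ) : EReal) := by
    have : (x : ℝ) - y = ((x : ℝ) + b) - (y + b) := by ring
    rw [this]; norm_cast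
  rw [e, EReal.abs_def, ← ENNReal.ofReal_coe_nnreal]
  apply ENNReal.ofReal_le_ofReal
  have h1 : (x : ℝ) ≤ y + R := by exact_mod_cast hxy
  have h2 : (y : ℝ) ≤ x + R := by exact_mod_cast hyx
  rw [abs_le]; constructor <;> linarith

/-- H is a Carathéodory function: continuous in x by the Lipschitz bound and continuous in u because
a finite convex function on ℝ^N is. Convexity enters only here. -/
lemma measurable_uncurry_objective {H : (Fin N → ℝ) → (Fin N → ℝ) → ℝ} {r : NNReal}
    (hlip : ∀ x x' u, |H x u - H x' u| ≤ r * l1Dist x x')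
    (hconv : ∀ x, ConvexOn ℝ Set.univ (H x)) : Measurable fun p : _ × _ => H p.1 p.2 :=
  measurable_uncurry_of_continuous_of_measurable
    (fun u => continuous_of_abs_sub_le_l1Dist fun x x' => hlip x x' u)
    (fun x => (continuousOn_univ.1 ((hconv x).continuousOn isOpen_univ)).measurable)

/-- Each marginal is a mixture of conditional laws, so it inherits the exponential moment. This
serves to show that v(μ) is finite. -/
lemma lintegral_l1Dist_zero_ne_top {μ : Measure (Fin N → ℝ)} [IsProbabilityMeasure μ]
    {a lam : Fin N → ℝ} (ha : ∀ t, 0 < a t) (hEXP : CondEXP μ a lam) :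
    ∫⁻ x, ENNReal.ofReal (l1Dist x 0) ∂μ ≠ ⊤ := by
  have hint : ∀ t, Integrable (fun x : Fin N → ℝ => x t) μ := by
    intro t
    have hm : Measurable fun x : Fin N → ℝ => x t := measurable_pi_apply t
    have : IsProbabilityMeasure (μ.map fun x => x t) :=
      Measure.isProbabilityMeasure_map hm.aemeasurable
    refine (integrable_map_measure (f := fun x : Fin N → ℝ => x t) (g := id)
      measurable_id.aestronglyMeasurable hm.aemeasurable).1
      (integrable_id_of_lintegral_exp_sq_le (ha t) (L := lam t) ?_)
    let g : ℝ → ENNReal := fun z => ENNReal.ofReal (Real.exp (a t * z ^ 2))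
    have hg : Measurable g := by fun_prop
    have h1 : ∫⁻ z, g z ∂(μ.map fun x => x t) =
        ∫⁻ x, ∫⁻ z, g z ∂(condLaw μ t (initSeg t t.isLt.le x)) ∂μ := by
      have h := congrArg (fun m : Measure ((Fin t → ℝ) × ℝ) => ∫⁻ p, g p.2 ∂m) (compProd_map_condDistrib (μ := μ)
        (X := initSeg t t.isLt.le) hm.aemeasurable)
      beta_reduce at h
      rw [Measure.lintegral_compProd (hg.fun_comp measurable_snd),
        lintegral_map (Measurable.lintegral_kernel hg) (measurable_initSeg _),
        lintegral_map (hg.fun_comp measurable_snd) ((measurable_initSeg _).prodMk hm)] at h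
      rw [lintegral_map hg hm]
      exact h.symm
    change ∫⁻ z, g z ∂_ ≤ _
    rw [h1]
    calc _ ≤ ∫⁻ _, ENNReal.ofReal (Real.exp (lam t)) ∂μ := lintegral_mono_ae (hEXP t)
      _ = _ := by simp
  have : Integrable (fun x : Fin N → ℝ => l1Dist x 0) μ := by
    unfold l1Dist
    simp only [Pi.zero_apply, sub_zero]
    exact integrable_finsetSum _ fun t _ => (hint t).abs
  exact this.lintegral_lt_top.ne

/-- Stability of the value of a program along a plan that is a noise transport both ways. -/
theorem abs_progValue_sub_le {μ ν : Measure (Fin N → ℝ)} [IsProbabilityMeasure μ]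
    [IsProbabilityMeasure ν] {a lam : Fin N → ℝ} (ha : ∀ t, 0 < a t) (hEXP : CondEXP μ a lam)
    {γ : Measure ((Fin N → ℝ) × (Fin N → ℝ))} (hμγ : IsNoiseTransport μ γ)
    (hνγ : IsNoiseTransport ν (γ.map Prod.swap)) {r : NNReal}
    {H : (Fin N → ℝ) → (Fin N → ℝ) → ℝ} (hb : ∃ b : ℝ, ∀ x u, b ≤ H x u)
    (hlip : ∀ x x' u, |H x u - H x' u| ≤ r * l1Dist x x')
    (hconv : ∀ x, ConvexOn ℝ Set.univ (H x)) :
    (progValue H μ - progValue H ν).abs ≤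
      r * ∫⁻ z, ENNReal.ofReal (l1Dist z.1 z.2) ∂γ := by
  obtain ⟨b, hb⟩ := hb
  have hH := measurable_uncurry_objective hlip hconv
  have hsnd : γ.map Prod.snd = ν := by
    rw [← hνγ.map_fst, Measure.map_map measurable_fst measurable_swap]; rfl
  have hsnd' : (γ.map Prod.swap).map Prod.snd = μ := by
    rw [← hμγ.map_fst, Measure.map_map measurable_snd measurable_swap]; rfl
  have hcost : ∫⁻ z, ENNReal.ofReal (l1Dist z.1 z.2) ∂(γ.map Prod.swap) =
      ∫⁻ z, ENNReal.ofReal (l1Dist z.1 z.2) ∂γ := by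
    rw [lintegral_map measurable_l1Dist.ennreal_ofReal measurable_swap]
    exact lintegral_congr fun z => by rw [Prod.fst_swap, Prod.snd_swap, l1Dist_comm]
  rw [progValue_eq_shiftedValue_add hH hb, progValue_eq_shiftedValue_add hH hb]
  refine EReal.abs_add_sub_add_le b ?_ ?_ ?_
  -- The zero control has finite cost under μ, since H(x, 0) grows at most linearly in x.
  · have h0 : (fun _ _ => 0 : (t : Fin N) → (Fin (t + 1) → ℝ) → ℝ) ∈ adaptedControls N :=
      fun t => measurable_const
    refine ne_top_of_le_ne_top ?_ (iInf₂_le _ h0)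
    refine ne_top_of_le_ne_top (b := ENNReal.ofReal (H 0 0 - b) +
      r * ∫⁻ x, ENNReal.ofReal (l1Dist x 0) ∂μ) (ENNReal.add_ne_top.2 ⟨ENNReal.ofReal_ne_top,
        ENNReal.mul_ne_top ENNReal.coe_ne_top (lintegral_l1Dist_zero_ne_top ha hEXP)⟩) ?_
    have hm : Measurable fun x : Fin N → ℝ => ENNReal.ofReal (l1Dist x 0) :=
      (measurable_l1Dist.fun_comp (measurable_id.prodMk measurable_const)).ennreal_ofReal
    calc _ ≤ ∫⁻ x, (ENNReal.ofReal (H 0 0 - b) + r * ENNReal.ofReal (l1Dist x 0)) ∂μ := by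
          refine lintegral_mono fun x => ?_
          have h := (le_abs_self _).trans (hlip x 0 0)
          have e : controlPath (fun _ _ => 0 : (t : Fin N) → (Fin (t + 1) → ℝ) → ℝ) x = 0 := rfl
          simp only [e]
          calc _ ≤ ENNReal.ofReal ((H 0 0 - b) + r * l1Dist x 0) :=
                ENNReal.ofReal_le_ofReal (by linarith)
            _ ≤ _ := ENNReal.ofReal_add_le
            _ = _ := by rw [ENNReal.ofReal_mul r.coe_nonneg, ENNReal.ofReal_coe_nnreal]
      _ = _ := by
          rw [lintegral_add_left measurable_const, lintegral_const_mul _ hm]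
          simp
  · conv_rhs => rw [shiftedValue, iInf_subtype', ENNReal.iInf_add]
    exact le_iInf fun u => hμγ.iInf_lintegral_le hsnd hH hlip u.2
  · conv_rhs => rw [shiftedValue, iInf_subtype', ENNReal.iInf_add, ← hcost]
    exact le_iInf fun u => hνγ.iInf_lintegral_le hsnd' hH hlip u.2

end ProgValue

/-! ### The main result -/

section Main

variable {N : ℕ}

lemma CondEXP.lam_nonneg {μ : Measure (Fin N → ℝ)} [IsProbabilityMeasure μ]
    {a lam : Fin N → ℝ} (ha : ∀ t, 0 < a t) (hEXP : CondEXP μ a lam) (t : Fin N) : 0 ≤ lam t := by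
  obtain ⟨x, hx⟩ := (hEXP t).exists
  exact nonneg_of_lintegral_exp_sq_le (ha t) hx

lemma bicausalConst_pos {a lam : Fin N → ℝ} (hN : 0 < N) (ha : ∀ t, 0 < a t)
    (hlam : ∀ t, 0 ≤ lam t) {C : ℝ} (hC : 0 < C) : 0 < bicausalConst a lam C := by
  have : Nonempty (Fin N) := ⟨⟨0, hN⟩⟩
  refine Real.sqrt_pos.2 (mul_pos two_pos (Finset.sum_pos (fun j _ => ?_) Finset.univ_nonempty))
  have := ha j.rev
  have := hlam j.rev
  positivity

/-- Cauchy–Schwarz between the coefficients and √h_t; reversing time turns the squared coefficients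
into K². -/
lemma sum_mul_rpow_half_le {a lam : Fin N → ℝ} (ha : ∀ t, 0 < a t)
    (hlam : ∀ t, 0 ≤ lam t) {C : ℝ} (hC : 0 < C) (h : Fin N → ENNReal) :
    ∑ t, ENNReal.ofReal (1 + C) ^ (t.rev : ℕ) *
        (ENNReal.ofReal (2 * ((1 + lam t) / a t)) * h t) ^ (1 / 2 : ℝ) ≤
      ENNReal.ofReal (bicausalConst a lam C) * (∑ t, h t) ^ (1 / 2 : ℝ) := by
  let f : Fin N → ENNReal := fun t => ENNReal.ofReal (1 + C) ^ (t.rev : ℕ) *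
    ENNReal.ofReal (2 * ((1 + lam t) / a t)) ^ (1 / 2 : ℝ)
  have e : ∀ x : ENNReal, (x ^ (1 / 2 : ℝ)) ^ (2 : ℝ) = x := fun x => by
    rw [← ENNReal.rpow_mul]; norm_num
  have hnn : ∀ t, 0 ≤ (1 + lam t) / a t := fun t =>
    div_nonneg (by linarith [hlam t]) (ha t).le
  have hf2 : ∑ t, f t ^ (2 : ℝ) = ENNReal.ofReal
      (2 * ∑ j : Fin N, (1 + C) ^ (2 * (j : ℕ)) * ((1 + lam j.rev) / a j.rev)) := by
    rw [← Equiv.sum_comp Fin.revPerm, Finset.mul_sum, ENNReal.ofReal_sum_of_nonneg]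
    · refine Finset.sum_congr rfl fun j _ => ?_
      simp only [f, Fin.revPerm_apply, Fin.rev_rev]
      rw [ENNReal.mul_rpow_of_nonneg _ _ (by norm_num), e, ENNReal.rpow_two, ← pow_mul,
        ← ENNReal.ofReal_pow (by positivity), ← ENNReal.ofReal_mul (by positivity), mul_comm _ 2]
      congr 1; ring
    · intro j _
      have := hnn j.rev
      positivity
  calc _ = ∑ t, f t * h t ^ (1 / 2 : ℝ) := by
        refine Finset.sum_congr rfl fun t _ => ?_
        rw [ENNReal.mul_rpow_of_nonneg _ _ (by norm_num), mul_assoc]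
    _ ≤ (∑ t, f t ^ (2 : ℝ)) ^ (1 / 2 : ℝ) * (∑ t, (h t ^ (1 / 2 : ℝ)) ^ (2 : ℝ)) ^ (1 / 2 : ℝ) :=
        ENNReal.inner_le_Lp_mul_Lq _ _ _ Real.HolderConjugate.two_two
    _ = _ := by
        simp only [e]
        rw [hf2, bicausalConst, Real.sqrt_eq_rpow, ENNReal.ofReal_rpow_of_nonneg _ (by norm_num)]
        exact mul_nonneg two_pos.le (Finset.sum_nonneg fun j _ =>
          mul_nonneg (by positivity) (hnn j.rev))

theorem mainTheorem4 {N : ℕ} (μ : Measure (Fin N → ℝ)) [IsProbabilityMeasure μ]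
    (a lam : Fin N → ℝ) (ha : ∀ t, 0 < a t) (C : ℝ) (hC : 0 < C)
    (hEXP : CondEXP μ a lam) (hLIP : CondLIP μ C)
    (ν : Measure (Fin N → ℝ)) [IsProbabilityMeasure ν] :
    bicausalW1 μ ν ≤
        ENNReal.ofReal (bicausalConst a lam C) * (InformationTheory.klDiv ν μ) ^ (1 / 2 : ℝ) ∧
      ∀ (r : NNReal) (H : (Fin N → ℝ) → (Fin N → ℝ) → ℝ),
        (∃ b : ℝ, ∀ x u, b ≤ H x u) →
        (∀ x x' u, |H x u - H x' u| ≤ r * l1Dist x x') →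
        (∀ x, ConvexOn ℝ Set.univ (H x)) →
        (progValue H μ - progValue H ν).abs ≤
          r * ENNReal.ofReal (bicausalConst a lam C) *
            (InformationTheory.klDiv ν μ) ^ (1 / 2 : ℝ) := by
  have hlam := hEXP.lam_nonneg ha
  by_cases hkl : InformationTheory.klDiv ν μ = ⊤
  -- For N = 0 the constant is 0 and 0 · ∞ would be useless, but on a one-point space the entropy is
  -- 0.
  · have hN : 0 < N := by
      rcases Nat.eq_zero_or_pos N with rfl | hN
      · have : ν = μ := by
          ext s
          rcases s.eq_empty_or_nonempty with rfl | hs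
          · simp
          · simp [hs.eq_univ]
        rw [this, InformationTheory.klDiv_self] at hkl
        exact absurd hkl ENNReal.zero_ne_top
      · exact hN
    have hK : ENNReal.ofReal (bicausalConst a lam C) ≠ 0 :=
      (ENNReal.ofReal_pos.2 (bicausalConst_pos hN ha hlam hC)).ne'
    have htop : (⊤ : ENNReal) ^ (1 / 2 : ℝ) = ⊤ := ENNReal.top_rpow_of_pos (by norm_num)
    rw [hkl, htop, ENNReal.mul_top hK]
    refine ⟨le_top, fun r H hb hlip hconv => ?_⟩
    -- For r = 0 the right side is 0 despite the infinite entropy. The independent coupling works,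
    -- since its cost is multiplied by 0 even if infinite.
    by_cases hr : r = 0
    · have h := abs_progValue_sub_le ha hEXP (isNoiseTransport_prod μ ν)
        (by rw [Measure.prod_swap]; exact isNoiseTransport_prod ν μ) hb hlip hconv
      rw [hr, ENNReal.coe_zero, zero_mul] at h
      exact h.trans zero_le
    · rw [ENNReal.mul_top (mul_ne_zero (by exact_mod_cast hr) hK)]
      exact le_top
  · obtain ⟨γ, _, hμγ, hνγ, h, hh, hcost⟩ := exists_noiseTransport μ ν a lam ha hC.le hEXP hLIP hkl
    have hcost' : ∫⁻ z, ENNReal.ofReal (l1Dist z.1 z.2) ∂γ ≤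
        ENNReal.ofReal (bicausalConst a lam C) *
          (InformationTheory.klDiv ν μ) ^ (1 / 2 : ℝ) := by
      refine (hcost.trans (sum_mul_rpow_half_le ha hlam hC h)).trans ?_
      gcongr
    refine ⟨?_, fun r H hb hlip hconv => ?_⟩
    · have hsnd : γ.map Prod.snd = ν := by
        rw [← hνγ.map_fst, Measure.map_map measurable_fst measurable_swap]; rfl
      have hsnd' : (γ.map Prod.swap).map Prod.snd = μ := by
        rw [← hμγ.map_fst, Measure.map_map measurable_snd measurable_swap]; rfl
      exact (iInf₂_le (⟨γ, inferInstance⟩ : ProbabilityMeasure _)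
        ⟨hμγ.isCausalPlan hsnd, hνγ.isCausalPlan hsnd'⟩).trans hcost'
    · rw [mul_assoc]
      exact (abs_progValue_sub_le ha hEXP hμγ hνγ hb hlip hconv).trans (by gcongr)

end Main
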